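/- **Model.** Let $\lambda_{BS},\lambda_b>0$, $0\le L_{\min}<L_{\max}$ and $0\le\mu\le1$. The base stations (BSs) form a homogeneous Poisson point process $\Psi_{BS}=\{y_i\}$ in $\mathbb R^2$ of density $\lambda_{BS}$. The blockages follow the line Boolean model: they are line segments whose midpoints form a homogeneous Poisson point process of density $\lambda_b$, with i.i.d. lengths $L$ uniform on $[L_{\min},L_{\max}]$ and i.i.d. angles uniform on $[0,2\pi)$. Independently, each blockage carries, with probability $\mu$, a reconfigurable intelligent surface (RIS) on one side, chosen by a fair coin, so that the midpoints of the RIS-equipped blockages form a Poisson point process $\Psi_R$ of density $\lambda_R=\mu\lambda_b$. For points $a,b$ let $\delta^{a,b}=1$ if no blockage meets the segment from $a$ to $b$, and $\delta^{a,b}=0$ otherwise. For an RIS with midpoint $z$ let $\kappa_z^{u,y}=1$ if $u$ and $y$ both lie strictly on its RIS-equipped side, and $\kappa_z^{u,y}=0$ otherwise. Blockages of different links are independent: for every BS $y_i$, the blockages seen by the direct user-BS link, the blockages that offer RISs for this link, and, for each such RIS, the blockages seen by its user-RIS hop and by its RIS-BS hop are mutually independent copies of the line Boolean model, independent over all $i$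 and independent of $\Psi_{BS}$. (All quantities $\delta^{\cdot,\cdot}$ and $\Psi_R$ below are evaluated with the copies that belong to the link in question.) **Theorem.** Let the typical user be at $u\in\mathbb R^2$ (without loss of generality the origin). The average fraction of blind-spot area, that is, of the area with neither a direct nor an indirect (via an RIS) line-of-sight link to any BS, defined at the typical user by $$\mathcal E=\mathbb E\Big[\prod_{y\in\Psi_{BS}}\Big(1-\Big(\delta^{u,y}+(1-\delta^{u,y})\Big(1-\prod_{z\in\Psi_R}\big(1-\delta^{z,u}\delta^{z,y}\kappa_z^{u,y}\big)\Big)\Big)\Big)\Big],$$ equals $$\mathcal E=\exp\Big(-2\pi\int_0^\infty\lambda_{BS}P_v(r)\,r\,dr\Big),$$ where the integral converges and $$P_v(r)=P_{\rm LoS}(r)+P_{\rm NLoS}(r)P_I(r),\qquad P_{\rm LoS}(r)=e^{-\beta r},\quad P_{\rm NLoS}=1-P_{\rm LoS},\quad \beta=\frac{2\lambda_b\,\mathbb E[L]}{\pi},$$ $$P_I(r)=1-\exp\Big(-\lambda_R\int_{-\pi}^{\pi}\int_0^\infty a_i(r,t,\phi)\,t\,dt\,d\phi\Big),$$ $$a_i(r,t,\phi)=\tfrac12\,P_{\rm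 LoS}(t)\,P_{\rm LoS}\big(\sqrt{r^2+t^2-2rt\cos\phi}\big)\Big(1-\tfrac1\pi\arccos\frac{t-r\cos\phi}{\sqrt{t^2+r^2-2rt\cos\phi}}\Big).$$ Here $P_{\rm LoS}(r)$ is the probability that a link of length $r$ is free of blockages, $P_I(r)$ the probability that a user and a BS at distance $r$ have at least one indirect line-of-sight link through an RIS, and $P_v(r)$ the probability that they have a direct or an indirect one. -/

import Mathlib

open MeasureTheory ProbabilityTheory Set
open scoped ENNReal

noncomputable section

/-- The Euclidean plane. -/
abbrev Plane : Type := EuclideanSpace ℝ (Fin 2)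

/-! ### Poisson point processes -/

/-- The number of points of the configuration `x 0, x 1, …` that lie in `B`. -/
def pointCount {X : Type*} (x : ℕ → X) (B : Set X) : ℕ∞ :=
  Set.encard {n | x n ∈ B}

/-- The random points `x 0, x 1, …` form a Poisson point process with intensity measure `Λ` on `X`
(of infinite total mass, so that there are infinitely many points): the numbers of points in
disjoint sets of finite intensity are independent, and the number of points in `B` is Poisson
distributed with mean `Λ B`. -/
structure IsPoissonProcess {Ω X : Type*} [MeasurableSpace Ω] [MeasurableSpace X]
    (P : Measure Ω) (x : ℕ → Ω → X) (Λ : Measure X) : Prop where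
  measurable : ∀ n, Measurable (x n)
  joint_count : ∀ (m : ℕ) (B : Fin m → Set X) (k : Fin m → ℕ),
    (∀ i, MeasurableSet (B i)) → (∀ i, Λ (B i) ≠ ∞) → Pairwise (fun i j => Disjoint (B i) (B j)) →
    P {ω | ∀ i, pointCount (fun n => x n ω) (B i) = (k i : ℕ∞)} =
      ∏ i, poissonMeasure (Λ (B i)).toNNReal {k i}

/-! ### The line Boolean model of blockages, a fraction of which carries a RIS -/

/-- A blockage: the midpoint, the length and the angle of a line segment, the side of the segment
on which a RIS would be mounted, and whether the blockage is equipped with a RIS. -/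
abbrev Blockage : Type := Plane × ℝ × ℝ × Bool × Bool

namespace Blockage

def midpoint (b : Blockage) : Plane := b.1
def length (b : Blockage) : ℝ := b.2.1
def angle (b : Blockage) : ℝ := b.2.2.1
def side (b : Blockage) : Bool := b.2.2.2.1
def hasRIS (b : Blockage) : Bool := b.2.2.2.2

/-- The unit vector along the blockage. -/
def direction (b : Blockage) : Plane := !₂[Real.cos b.angle, Real.sin b.angle]

/-- The unit normal vector that points to the RIS side of the blockage. -/
def normal (b : Blockage) : Plane :=
  (if b.side then (1 : ℝ) else -1) • !₂[-Real.sin b.angle, Real.cos b.angle]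

/-- The line segment occupied by the blockage. -/
def body (b : Blockage) : Set Plane :=
  segment ℝ (b.midpoint - (b.length / 2) • b.direction) (b.midpoint + (b.length / 2) • b.direction)

end Blockage

/-- The law of the length of a blockage: uniform on `[Lmin, Lmax]`. -/
def lengthLaw (Lmin Lmax : ℝ) : Measure ℝ := cond volume (Icc Lmin Lmax)

/-- The law of the angle of a blockage: uniform on `[0, 2π)`. -/
def angleLaw : Measure ℝ := cond volume (Ico 0 (2 * Real.pi))

/-- The intensity of the marked line Boolean model: midpoints have density `lamB`; independently of
each other and of the midpoint, the length and the angle are uniform, the RIS side is a fair coin,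
and the blockage is equipped with a RIS with probability `μ`. -/
def blockageIntensity (lamB Lmin Lmax : ℝ) (μ : unitInterval) : Measure Blockage :=
  (ENNReal.ofReal lamB • (volume : Measure Plane)).prod
    ((lengthLaw Lmin Lmax).prod
      (angleLaw.prod ((PMF.uniformOfFintype Bool).toMeasure.prod (bernoulliMeasure true false μ))))

/-! ### Line-of-sight -/

/-- The path between `a` and `b` is free of the blockages `B`. -/
def LoS (B : ℕ → Blockage) (a b : Plane) : Prop :=
  ∀ j, Disjoint (B j).body (segment ℝ a b)

/-- A RIS on the blockage `z` is oriented so that it can serve `u` and `y`: both are facing the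
RIS-equipped side. -/
def Facing (z : Blockage) (u y : Plane) : Prop :=
  0 < inner ℝ z.normal (u - z.midpoint) ∧ 0 < inner ℝ z.normal (y - z.midpoint)

open Classical in
/-- `δ^{a,b}`: the indicator that the path between `a` and `b` is free of the blockages `B`. -/
def losIndicator (B : ℕ → Blockage) (a b : Plane) : ℝ := if LoS B a b then 1 else 0

open Classical in
/-- `κ_z^{u,y}`: the indicator that the RIS on `z` is suitably oriented for `u` and `y`. -/
def facingIndicator (z : Blockage) (u y : Plane) : ℝ := if Facing z u y then 1 else 0

/-! ### Independent blockages of different links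

Blockages of different links are independent: every link sees a line Boolean model of its own. The
constructors list these models for the link between the user and the `i`-th base station, the
blockages that offer RISs for this link, and the two hops (user to RIS, RIS to base station)
through the RIS on the `j`-th of these blockages. -/
inductive BlockageCopy : Type
  | direct (i : ℕ)
  | carriers (i : ℕ)
  | userToRIS (i j : ℕ)
  | risToBS (i j : ℕ)

/-- The link between `u` and a base station at `y`, the `i`-th one, has an indirect LoS-link. -/
def IndirectLoS (blk : BlockageCopy → ℕ → Blockage) (u y : Plane) (i : ℕ) : Prop :=
  ∃ j, (blk (.carriers i) j).hasRIS = true ∧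
    LoS (blk (.userToRIS i j)) (blk (.carriers i) j).midpoint u ∧
    LoS (blk (.risToBS i j)) (blk (.carriers i) j).midpoint y ∧
    Facing (blk (.carriers i) j) u y

/-- `1 - ∏_{z ∈ Ψ_R} (1 - δ^{z,u} δ^{z,y} κ_z^{u,y})`, for the RISs offered to the `i`-th base
station, at `y`. -/
def indirectIndicator (blk : BlockageCopy → ℕ → Blockage) (u y : Plane) (i : ℕ) : ℝ :=
  1 - ∏' j : {j : ℕ // (blk (.carriers i) j).hasRIS = true},
    (1 - losIndicator (blk (.userToRIS i j)) (blk (.carriers i) j).midpoint u *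
      losIndicator (blk (.risToBS i j)) (blk (.carriers i) j).midpoint y *
      facingIndicator (blk (.carriers i) j) u y)

/-- The average ratio of blind-spot areas, for a typical user located at `u`:
`E[∏_{y ∈ Ψ_BS} (1 - (δ^{u,y} + (1 - δ^{u,y}) (1 - ∏_{z ∈ Ψ_R} (1 - δ^{z,u} δ^{z,y} κ_z^{u,y}))))]`.
-/
def blindSpotRatio {Ω : Type*} [MeasurableSpace Ω] (P : Measure Ω) (bs : ℕ → Ω → Plane)
    (blk : BlockageCopy → ℕ → Ω → Blockage) (u : Plane) : ℝ :=
  ∫ ω, ∏' i, (1 - (losIndicator (fun k => blk (.direct i) k ω) u (bs i ω) +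
    (1 - losIndicator (fun k => blk (.direct i) k ω) u (bs i ω)) *
      indirectIndicator (fun c k => blk c k ω) u (bs i ω) i)) ∂P

/-! ### The formulas -/

/-- `β = 2 λ_b E[L] / π`. -/
def beta (lamB Lmin Lmax : ℝ) : ℝ := 2 * lamB * (∫ l, l ∂(lengthLaw Lmin Lmax)) / Real.pi

def PLoS (lamB Lmin Lmax r : ℝ) : ℝ := Real.exp (-(beta lamB Lmin Lmax * r))

def PNLoS (lamB Lmin Lmax r : ℝ) : ℝ := 1 - PLoS lamB Lmin Lmax r

/-- `𝒞(r, t, φ)`. -/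
def orientationProb (r t φ : ℝ) : ℝ :=
  1 - 1 / Real.pi *
    Real.arccos ((t - r * Real.cos φ) / Real.sqrt (t ^ 2 + r ^ 2 - 2 * r * t * Real.cos φ))

/-- `a_i(r, t, φ)`. -/
def reflectionProb (lamB Lmin Lmax r t φ : ℝ) : ℝ :=
  1 / 2 * PLoS lamB Lmin Lmax t *
    PLoS lamB Lmin Lmax (Real.sqrt (r ^ 2 + t ^ 2 - 2 * r * t * Real.cos φ)) *
    orientationProb r t φ

/-- `P_I(r)`, with RIS density `λ_R = μ λ_b`. -/
def PI (lamB Lmin Lmax : ℝ) (μ : unitInterval) (r : ℝ) : ℝ :=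
  1 - Real.exp (-((μ : ℝ) * lamB *
    ∫ φ in (-Real.pi)..Real.pi, ∫ t in Ioi (0 : ℝ), reflectionProb lamB Lmin Lmax r t φ * t))

/-- `P_v(r)`. -/
def Pv (lamB Lmin Lmax : ℝ) (μ : unitInterval) (r : ℝ) : ℝ :=
  PLoS lamB Lmin Lmax r + PNLoS lamB Lmin Lmax r * PI lamB Lmin Lmax μ r

end

/-! ### The probability generating functional of a Poisson process -/

/-! Every factor of the random product is 0 or 1, so the expectation is the probability that no base
station is visible. Given the base stations, visibility of the `i`-th one depends only on the
blockage copies of link `i`. The visible base stations are therefore an independent thinning of a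
Poisson process, and the probability that there are none is the exponential of minus the integral of
the retention probability `Pv` against the intensity. The same principle,
`IsPoissonProcess.prob_forall_notMem`, also acts inside a single link: the RISs that serve it are a
thinning of the carriers, with the pairs of hop copies as marks. It rests on the generating
functional `IsPoissonProcess.lintegral_prod`.

Two geometric averages feed these thinnings. Midpoints of segments of fixed length and angle that
meet a path fill a parallelogram; averaging its area over length and angle gives mean `β` times the
length of the path (`blockageIntensity_not_disjoint_body`), hence `PLoS`. The angles at which a RIS
faces both ends form an arc of length `π` minus the angle under which the RIS sees them
(`lintegral_marks_facing`). Polar coordinates around the user then produce the double integral in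
`PI` (`integral_servingDensity`).

The outer integral converges because `1 - exp (-x) ≤ x` bounds `PI` by a multiple of an integral
over RIS positions. Integrated over the base station, this is at most the total mass of a
convolution of two integrable functions. -/

theorem lintegral_pow_poissonMeasure (r : NNReal) {c : ℝ≥0∞} (hc : c ≤ 1) :
    ∫⁻ k, (1 - c) ^ k ∂(poissonMeasure r) = ENNReal.ofReal (Real.exp (-(c.toReal * r))) := by
  have hc' : c ≠ ∞ := ne_top_of_le_ne_top ENNReal.one_ne_top hc
  have hc1 : c.toReal ≤ 1 := by
    simpa using ENNReal.toReal_mono ENNReal.one_ne_top hc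
  have h1 : 1 - c = ENNReal.ofReal (1 - c.toReal) := by
    rw [ENNReal.ofReal_sub _ ENNReal.toReal_nonneg, ENNReal.ofReal_toReal hc', ENNReal.ofReal_one]
  set s := 1 - c.toReal with hs
  have hs0 : 0 ≤ s := by linarith
  rw [poissonMeasure, lintegral_sum_measure]
  simp only [lintegral_smul_measure, lintegral_dirac, smul_eq_mul, h1]
  have h2 : ∀ n : ℕ, ENNReal.ofReal (Real.exp (-r) * r ^ n / n.factorial) * ENNReal.ofReal s ^ n =
      ENNReal.ofReal (Real.exp (-r) * ((r * s) ^ n / n.factorial)) := by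
    intro n
    rw [← ENNReal.ofReal_pow hs0, ← ENNReal.ofReal_mul (by positivity)]
    congr 1
    rw [mul_pow]
    ring
  have h3 : HasSum (fun n : ℕ => Real.exp (-r) * ((r * s) ^ n / n.factorial))
      (Real.exp (-r) * Real.exp (r * s)) := by
    have := (NormedSpace.expSeries_div_hasSum_exp ((r : ℝ) * s)).mul_left (Real.exp (-r))
    rwa [← Real.exp_eq_exp_ℝ] at this
  simp only [h2]
  rw [← ENNReal.ofReal_tsum_of_nonneg (fun n => by positivity) h3.summable, h3.tsum_eq,
    ← Real.exp_add]
  congr 2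
  rw [hs]; ring

section Counts

variable {Ω X : Type*} [MeasurableSpace Ω] [MeasurableSpace X]

/-- There are only countably many `k`-element sets of indices, and the event says that one of them
is sent into `B`. -/
theorem measurableSet_natCast_le_pointCount {x : ℕ → Ω → X} (hx : ∀ n, Measurable (x n)) {B : Set X}
    (hB : MeasurableSet B) (k : ℕ) :
    MeasurableSet {ω | (k : ℕ∞) ≤ pointCount (fun n => x n ω) B} := by
  have : {ω | (k : ℕ∞) ≤ pointCount (fun n => x n ω) B} =
      ⋃ s : {s : Finset ℕ // s.card = k}, ⋂ n ∈ s.1, x n ⁻¹' B := by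
    ext ω
    simp only [mem_ofPred_eq, mem_iUnion, mem_iInter, mem_preimage, pointCount]
    constructor
    · intro h
      obtain ⟨t, ht, htk⟩ := Set.exists_subset_encard_eq h
      have hfin : t.Finite := Set.finite_of_encard_eq_coe htk
      refine ⟨⟨hfin.toFinset, ?_⟩, fun n hn => ht (by simpa using hn)⟩
      rw [hfin.encard_eq_coe_toFinset_card] at htk
      exact_mod_cast htk
    · rintro ⟨⟨s, hs⟩, h⟩
      rw [← hs, ← Set.encard_coe_eq_coe_finsetCard]
      exact Set.encard_le_encard fun n hn => h n (by simpa using hn)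
  rw [this]
  exact MeasurableSet.iUnion fun s => Finset.measurableSet_biInter _ fun n _ => hx n hB

theorem measurableSet_pointCount_eq {x : ℕ → Ω → X} (hx : ∀ n, Measurable (x n)) {B : Set X}
    (hB : MeasurableSet B) (k : ℕ) :
    MeasurableSet {ω | pointCount (fun n => x n ω) B = k} := by
  have : {ω | pointCount (fun n => x n ω) B = k} =
      {ω | (k : ℕ∞) ≤ pointCount (fun n => x n ω) B} \
        {ω | ((k + 1 : ℕ) : ℕ∞) ≤ pointCount (fun n => x n ω) B} := by
    ext ω
    simp only [mem_ofPred_eq, mem_sdiff, not_le]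
    rw [Nat.cast_add, Nat.cast_one, ENat.lt_add_one_iff (ENat.natCast_ne_top k)]
    exact ⟨fun h => ⟨h.ge, h.le⟩, fun h => le_antisymm h.2 h.1⟩
  rw [this]
  exact (measurableSet_natCast_le_pointCount hx hB k).diff
    (measurableSet_natCast_le_pointCount hx hB (k + 1))

theorem measurable_toNat_pointCount {x : ℕ → Ω → X} (hx : ∀ n, Measurable (x n)) {B : Set X}
    (hB : MeasurableSet B) : Measurable fun ω => (pointCount (fun n => x n ω) B).toNat := by
  refine measurable_to_countable' fun k => ?_
  rcases eq_or_ne k 0 with rfl | hk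
  -- `ENat.toNat` sends `⊤` to `0`, so the fibre over `0` also contains the event of infinitely many
  -- points.
  · have : (fun ω => (pointCount (fun n => x n ω) B).toNat) ⁻¹' {0} =
        {ω | pointCount (fun n => x n ω) B = (0 : ℕ)} ∪
          ⋂ j : ℕ, {ω | (j : ℕ∞) ≤ pointCount (fun n => x n ω) B} := by
      ext ω
      simp only [mem_preimage, mem_singleton_iff, mem_union, mem_ofPred_eq, mem_iInter,
        ENat.toNat_eq_zero, Nat.cast_zero]
      refine or_congr Iff.rfl ⟨fun h => by simp [h], fun h => ?_⟩
      exact ENat.eq_top_iff_forall_ge.2 h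
    rw [this]
    exact (measurableSet_pointCount_eq hx hB 0).union
      (MeasurableSet.iInter fun j => measurableSet_natCast_le_pointCount hx hB j)
  · convert measurableSet_pointCount_eq hx hB k using 1
    ext ω
    simp only [mem_preimage, mem_singleton_iff, mem_ofPred_eq]
    exact ENat.toNat_eq_iff hk

theorem eventually_card_filter_mem {X : Type*} {x : ℕ → X} {B : Set X} [DecidablePred (· ∈ B)]
    (h : pointCount x B ≠ ⊤) :
    ∀ᶠ N in Filter.atTop, ((Finset.range N).filter fun n => x n ∈ B).card =
      (pointCount x B).toNat := by
  have hfin : {n | x n ∈ B}.Finite := Set.encard_ne_top_iff.1 h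
  obtain ⟨N, hN⟩ := hfin.bddAbove
  filter_upwards [Filter.eventually_gt_atTop N] with M hM
  have : ((Finset.range M).filter fun n => x n ∈ B) = hfin.toFinset := by
    ext n
    simp only [Finset.mem_filter, Finset.mem_range, Finite.mem_toFinset, mem_ofPred_eq,
      and_iff_right_iff_imp]
    exact fun hn => (hN hn).trans_lt hM
  rw [this, pointCount, hfin.encard_eq_coe_toFinset_card, ENat.toNat_natCast]

variable {P : Measure Ω} {x : ℕ → Ω → X} {Λ : Measure X}

theorem IsPoissonProcess.prob_pointCount_eq (h : IsPoissonProcess P x Λ) {ι : Type*} [Fintype ι]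
    (B : ι → Set X) (k : ι → ℕ) (hB : ∀ i, MeasurableSet (B i)) (hfin : ∀ i, Λ (B i) ≠ ∞)
    (hdisj : Pairwise fun i j => Disjoint (B i) (B j)) :
    P {ω | ∀ i, pointCount (fun n => x n ω) (B i) = (k i : ℕ∞)} =
      ∏ i, poissonMeasure (Λ (B i)).toNNReal {k i} := by
  let e := Fintype.equivFin ι
  have := h.joint_count (Fintype.card ι) (B ∘ e.symm) (k ∘ e.symm) (fun i => hB _)
    (fun i => hfin _) (fun i j hij => hdisj (e.symm.injective.ne hij))
  rw [← e.symm.prod_comp]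
  refine Eq.trans (congrArg P (Set.ext fun ω => ?_)) this
  exact e.symm.forall_congr_right.symm

/-- The finite count vectors already carry the masses of a product of Poisson laws. These sum to
one, so infinite counts are null and the joint law is that product. -/
theorem IsPoissonProcess.ae_pointCount_ne_top_and_map_pointCount [IsProbabilityMeasure P]
    (h : IsPoissonProcess P x Λ)
    {ι : Type*} [Fintype ι]
    (B : ι → Set X) (hB : ∀ i, MeasurableSet (B i)) (hfin : ∀ i, Λ (B i) ≠ ∞)
    (hdisj : Pairwise fun i j => Disjoint (B i) (B j)) :
    (∀ᵐ ω ∂P, ∀ i, pointCount (fun n => x n ω) (B i) ≠ ⊤) ∧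
      P.map (fun ω i => (pointCount (fun n => x n ω) (B i)).toNat) =
        Measure.pi fun i => poissonMeasure (Λ (B i)).toNNReal := by
  set E : (ι → ℕ) → Set Ω := fun k => {ω | ∀ i, pointCount (fun n => x n ω) (B i) = (k i : ℕ∞)}
  have hEm : ∀ k, MeasurableSet (E k) := fun k => by
    have : E k = ⋂ i, {ω | pointCount (fun n => x n ω) (B i) = (k i : ℕ∞)} := by
      ext; simp [E]
    rw [this]
    exact MeasurableSet.iInter fun i => measurableSet_pointCount_eq h.measurable (hB i) _
  have hE : ∀ k, P (E k) = (Measure.pi fun i => poissonMeasure (Λ (B i)).toNNReal) {k} := by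
    intro k
    rw [Measure.pi_singleton]
    exact h.prob_pointCount_eq B k hB hfin hdisj
  have hEd : Pairwise (Function.onFun Disjoint E) := by
    intro k l hkl
    refine Set.disjoint_left.2 fun ω hk hl => hkl (funext fun i => ?_)
    exact_mod_cast (hk i).symm.trans (hl i)
  have hU : P (⋃ k, E k) = 1 := by
    rw [measure_iUnion hEd hEm, tsum_congr hE,
      ← measure_iUnion _ fun k => measurableSet_singleton k]
    · rw [Set.iUnion_singleton_eq_range, Set.range_id', measure_univ]
    · exact fun k l hkl => Set.disjoint_singleton.2 hkl
  have hae : ∀ᵐ ω ∂P, ∀ i, pointCount (fun n => x n ω) (B i) ≠ ⊤ := by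
    have : ∀ᵐ ω ∂P, ω ∈ ⋃ k, E k :=
      (mem_ae_iff_prob_eq_one (MeasurableSet.iUnion hEm)).2 hU
    filter_upwards [this] with ω hω i
    obtain ⟨k, hk⟩ := mem_iUnion.1 hω
    rw [hk i]
    exact ENat.natCast_ne_top _
  refine ⟨hae, Measure.ext_of_singleton fun k => ?_⟩
  rw [Measure.map_apply (measurable_pi_lambda _ fun i =>
    measurable_toNat_pointCount h.measurable (hB i)) (measurableSet_singleton k), ← hE k]
  refine measure_congr ?_
  filter_upwards [hae] with ω hω
  refine propext ⟨fun hk i => ?_, fun hk => funext fun i => ?_⟩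
  · have : (pointCount (fun n => x n ω) (B i)).toNat = k i := congrFun hk i
    rw [← this, ENat.natCast_toNat (hω i)]
  · change (pointCount (fun n => x n ω) (B i)).toNat = k i
    rw [hk i, ENat.toNat_natCast]

theorem antitone_prod_range_of_le_one {a : ℕ → ℝ≥0∞} (ha : ∀ n, a n ≤ 1) :
    Antitone fun N => ∏ n ∈ Finset.range N, a n :=
  antitone_nat_of_succ_le fun N => by
    rw [Finset.prod_range_succ]
    exact mul_le_of_le_one_right' (ha N)

/-- The partial products decrease, so their infimum serves as the infinite product without any
question of convergence. -/
theorem measurable_iInf_prod_one_sub (hx : ∀ n, Measurable (x n)) {g : X → ℝ≥0∞}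
    (hg : Measurable g) :
    Measurable fun ω => ⨅ N, ∏ n ∈ Finset.range N, (1 - g (x n ω)) := by
  have := fun n => hg.comp (hx n)
  simp only [Function.comp_def] at this
  fun_prop

/-- Grouping the points by the value `c` of `g` turns the product into `∏ c, (1 - c) ^ N c` with
independent Poisson counts `N c`; each factor has an explicit mean. -/
theorem IsPoissonProcess.lintegral_prod_simpleFunc [IsProbabilityMeasure P]
    (h : IsPoissonProcess P x Λ)
    (g : SimpleFunc X ℝ≥0∞) (hg1 : ∀ a, g a ≤ 1) (hgΛ : ∫⁻ a, g a ∂Λ ≠ ∞) :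
    ∫⁻ ω, ⨅ N, ∏ n ∈ Finset.range N, (1 - g (x n ω)) ∂P =
      ENNReal.ofReal (Real.exp (-(∫⁻ a, g a ∂Λ).toReal)) := by
  classical
  -- The value `0` is dropped: its fibre may have infinite intensity, but its points contribute only
  -- factors `1`.
  set s : Finset ℝ≥0∞ := g.range.filter (· ≠ 0) with hs
  have hs1 : ∀ c ∈ s, c ≤ 1 := by
    intro c hc
    obtain ⟨a, rfl⟩ := SimpleFunc.mem_range.1 (Finset.mem_filter.1 hc).1
    exact hg1 a
  have hfin : ∀ c : s, Λ (g ⁻¹' {c.1}) ≠ ∞ := fun c =>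
    ((SimpleFunc.finMeasSupp_iff.1 (SimpleFunc.FinMeasSupp.of_lintegral_ne_top
      (by rwa [SimpleFunc.lintegral_eq_lintegral] at hgΛ))) c.1 (Finset.mem_filter.1 c.2).2).ne
  have hdisj : Pairwise fun c d : s => Disjoint (g ⁻¹' {c.1}) (g ⁻¹' {d.1}) := by
    intro c d hcd
    exact Disjoint.preimage _ (Set.disjoint_singleton.2 (Subtype.coe_injective.ne hcd))
  obtain ⟨hae, hmap⟩ := h.ae_pointCount_ne_top_and_map_pointCount (fun c : s => g ⁻¹' {c.1})
    (fun c => g.measurableSet_fiber _) hfin hdisj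
  have hval : ∀ a, 1 - g a = ∏ c : s, if a ∈ g ⁻¹' {c.1} then 1 - c.1 else 1 := by
    intro a
    rw [Finset.prod_coe_sort s fun c => if a ∈ g ⁻¹' {c} then 1 - c else 1]
    simp only [mem_preimage, mem_singleton_iff]
    rw [Finset.prod_ite_eq]
    split_ifs with ha
    · rfl
    · have : g a = 0 := by
        by_contra h0
        exact ha (Finset.mem_filter.2 ⟨SimpleFunc.mem_range_self g a, h0⟩)
      simp [this]
  have hprod : ∀ᵐ ω ∂P, ⨅ N, ∏ n ∈ Finset.range N, (1 - g (x n ω)) =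
      ∏ c : s, (1 - c.1) ^ (pointCount (fun n => x n ω) (g ⁻¹' {c.1})).toNat := by
    filter_upwards [hae] with ω hω
    have hanti := antitone_prod_range_of_le_one (a := fun n => 1 - g (x n ω)) fun n => tsub_le_self
    refine tendsto_nhds_unique (tendsto_atTop_iInf hanti) (tendsto_const_nhds.congr' ?_)
    filter_upwards [Filter.eventually_all.2 fun c : s => eventually_card_filter_mem (hω c)]
      with N hN
    simp only [hval]
    rw [Finset.prod_comm]
    refine Finset.prod_congr rfl fun c _ => ?_
    rw [← hN c, Finset.prod_ite]
    simp
  rw [lintegral_congr_ae hprod]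
  have hm : Measurable fun ω (c : s) => (pointCount (fun n => x n ω) (g ⁻¹' {c.1})).toNat :=
    measurable_pi_lambda _ fun c =>
      measurable_toNat_pointCount h.measurable (g.measurableSet_fiber _)
  have h1 := lintegral_map (μ := P) (f := fun k : s → ℕ => ∏ c : s, (1 - c.1) ^ k c)
    (measurable_of_countable _) hm
  rw [← h1, hmap]
  have hind : iIndepFun (fun (c : s) (k : s → ℕ) => (1 - c.1) ^ k c)
      (Measure.pi fun c : s => poissonMeasure (Λ (g ⁻¹' {c.1})).toNNReal) :=
    iIndepFun_pi (X := fun (c : s) (k : ℕ) => (1 - c.1) ^ k)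
      fun c => (measurable_of_countable _).aemeasurable
  rw [lintegral_prod_eq_prod_lintegral_of_indepFun Finset.univ _ hind
    fun c => measurable_of_countable _]
  have h2 : ∀ c : s, ∫⁻ k : s → ℕ, (1 - c.1) ^ k c
      ∂(Measure.pi fun c : s => poissonMeasure (Λ (g ⁻¹' {c.1})).toNNReal) =
      ENNReal.ofReal (Real.exp (-(c.1.toReal * (Λ (g ⁻¹' {c.1})).toReal))) := by
    intro c
    have hmp := measurePreserving_eval
      (fun c : s => poissonMeasure (Λ (g ⁻¹' {c.1})).toNNReal) c
    have := hmp.lintegral_comp (f := fun k => (1 - c.1) ^ k) (measurable_of_countable _)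
    exact this.trans (lintegral_pow_poissonMeasure _ (hs1 c c.2))
  simp only [h2]
  rw [← ENNReal.ofReal_prod_of_nonneg fun c _ => (Real.exp_pos _).le, ← Real.exp_sum,
    Finset.sum_neg_distrib]
  congr 3
  rw [SimpleFunc.lintegral_eq_lintegral g, SimpleFunc.lintegral,
    ← Finset.sum_filter_of_ne (s := g.range) (p := (· ≠ 0)), ENNReal.toReal_sum]
  · simp only [ENNReal.toReal_mul]
    exact Finset.sum_coe_sort s fun c => c.toReal * (Λ (g ⁻¹' {c})).toReal
  · intro c hc
    exact ENNReal.mul_ne_top (ne_top_of_le_ne_top ENNReal.one_ne_top (hs1 c hc)) (hfin ⟨c, hc⟩)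
  · intro c _ hc h0
    simp [h0] at hc

/-- The probability generating functional of a Poisson process. -/
theorem IsPoissonProcess.lintegral_prod [IsProbabilityMeasure P] (h : IsPoissonProcess P x Λ)
    {g : X → ℝ≥0∞} (hg : Measurable g) (hg1 : ∀ a, g a ≤ 1) (hgΛ : ∫⁻ a, g a ∂Λ ≠ ∞) :
    ∫⁻ ω, ⨅ N, ∏ n ∈ Finset.range N, (1 - g (x n ω)) ∂P =
      ENNReal.ofReal (Real.exp (-(∫⁻ a, g a ∂Λ).toReal)) := by
  set G : ℕ → SimpleFunc X ℝ≥0∞ := SimpleFunc.eapprox g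
  have hmono : Monotone G := SimpleFunc.monotone_eapprox g
  have hsup : ∀ a, ⨆ k, G k a = g a := SimpleFunc.iSup_eapprox_apply hg
  have hle : ∀ k a, G k a ≤ g a := fun k a => hsup a ▸ le_iSup (fun k => G k a) k
  have hG := fun k => h.lintegral_prod_simpleFunc (G k) (fun a => (hle k a).trans (hg1 a))
    (ne_top_of_le_ne_top hgΛ (lintegral_mono (hle k)))
  have hlim : Filter.Tendsto (fun k => ∫⁻ a, G k a ∂Λ) Filter.atTop (nhds (∫⁻ a, g a ∂Λ)) := by
    have : ∫⁻ a, g a ∂Λ = ⨆ k, ∫⁻ a, G k a ∂Λ := by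
      rw [← lintegral_iSup (fun k => (G k).measurable) fun i j hij => hmono hij]
      simp only [hsup]
    rw [this]
    exact tendsto_atTop_iSup fun i j hij => lintegral_mono (hmono hij)
  -- Both limits are infima and hence commute, so only finite products have to be passed to the
  -- limit in `k`.
  have hpt : ∀ ω, ⨅ N, ∏ n ∈ Finset.range N, (1 - g (x n ω)) =
      ⨅ k, ⨅ N, ∏ n ∈ Finset.range N, (1 - G k (x n ω)) := by
    intro ω
    rw [iInf_comm]
    refine iInf_congr fun N => ?_
    have h1 : Filter.Tendsto (fun k => ∏ n ∈ Finset.range N, (1 - G k (x n ω))) Filter.atTop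
        (nhds (∏ n ∈ Finset.range N, (1 - g (x n ω)))) := by
      refine ENNReal.tendsto_finsetProd_of_ne_top _ (fun n _ => ?_) fun n _ => ?_
      · refine ENNReal.Tendsto.sub tendsto_const_nhds ?_ (Or.inl ENNReal.one_ne_top)
        rw [← hsup]
        exact tendsto_atTop_iSup fun i j hij => hmono hij _
      · exact ne_top_of_le_ne_top ENNReal.one_ne_top tsub_le_self
    refine tendsto_nhds_unique h1 (tendsto_atTop_iInf fun i j hij => ?_)
    exact Finset.prod_le_prod' fun n _ => tsub_le_tsub_left (hmono hij _) _
  have hanti : Antitone fun k ω => ⨅ N, ∏ n ∈ Finset.range N, (1 - G k (x n ω)) :=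
    fun i j hij ω => iInf_mono fun N =>
      Finset.prod_le_prod' fun n _ => tsub_le_tsub_left (hmono hij _) _
  simp only [hpt]
  rw [lintegral_iInf (fun k => measurable_iInf_prod_one_sub h.measurable (G k).measurable) hanti
    (by rw [hG]; exact ENNReal.ofReal_ne_top)]
  refine tendsto_nhds_unique (tendsto_atTop_iInf fun i j hij => lintegral_mono (hanti hij)) ?_
  simp only [hG]
  exact (ENNReal.continuous_ofReal.tendsto _).comp ((Real.continuous_exp.tendsto _).comp
    ((ENNReal.tendsto_toReal hgΛ).comp hlim).neg)

end Counts

/-! ### Poisson processes with independent marks -/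

section Marks

variable {Ω X E : Type*} [MeasurableSpace Ω] [MeasurableSpace X] [MeasurableSpace E]
  {P : Measure Ω} [IsProbabilityMeasure P] {x : ℕ → Ω → X} {M : ℕ → Ω → E} {A : Set (X × E)}

/-- Points and marks have a product joint law, so the points can be frozen by Fubini; the events for
different `n` then involve independent marks. -/
theorem prob_forall_lt_notMem_eq_lintegral_prod (hx : ∀ n, Measurable (x n))
    (hM : ∀ n, Measurable (M n)) (hMi : iIndepFun M P)
    (hxM : IndepFun (fun ω n => x n ω) (fun ω n => M n ω) P) (hA : MeasurableSet A)
    {g : X → ℝ≥0∞} (hg : ∀ n a, P {ω | (a, M n ω) ∈ A} = g a) (N : ℕ) :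
    P {ω | ∀ n < N, (x n ω, M n ω) ∉ A} =
      ∫⁻ ω, ∏ n ∈ Finset.range N, (1 - g (x n ω)) ∂P := by
  have hxm : Measurable fun ω n => x n ω := measurable_pi_lambda _ hx
  have hMm : Measurable fun ω n => M n ω := measurable_pi_lambda _ hM
  have hS : MeasurableSet {p : (ℕ → X) × (ℕ → E) | ∀ n < N, (p.1 n, p.2 n) ∉ A} := by
    have : {p : (ℕ → X) × (ℕ → E) | ∀ n < N, (p.1 n, p.2 n) ∉ A} =
        ⋂ n ∈ Finset.range N, (fun p => (p.1 n, p.2 n)) ⁻¹' Aᶜ := by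
      ext; simp
    rw [this]
    exact Finset.measurableSet_biInter _ fun n _ =>
      measurableSet_preimage (by fun_prop) hA.compl
  have h1 : P {ω | ∀ n < N, (x n ω, M n ω) ∉ A} =
      P.map (fun ω => (fun n => x n ω, fun n => M n ω))
        {p : (ℕ → X) × (ℕ → E) | ∀ n < N, (p.1 n, p.2 n) ∉ A} := by
    rw [Measure.map_apply (hxm.prodMk hMm) hS]
    rfl
  rw [h1, (indepFun_iff_map_prod_eq_prod_map_map hxm.aemeasurable hMm.aemeasurable).1 hxM]
  have : IsProbabilityMeasure (P.map fun ω n => M n ω) :=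
    Measure.isProbabilityMeasure_map hMm.aemeasurable
  rw [Measure.prod_apply hS, lintegral_map (measurable_measure_prodMk_left hS) hxm]
  refine lintegral_congr fun ω => ?_
  rw [Measure.map_apply hMm (measurable_prodMk_left hS)]
  have h2 := hMi.measure_inter_preimage_eq_mul (Finset.range N)
    (sets := fun n => {e | (x n ω, e) ∉ A}) fun n _ => (measurable_prodMk_left hA).compl
  convert h2 using 1
  · congr 1
    ext ω'
    simp
  · refine Finset.prod_congr rfl fun n _ => ?_
    rw [← hg n, ← prob_compl_eq_one_sub]
    · rfl
    · exact hM n (measurable_prodMk_left hA)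

/-- The void probability of the thinning of a Poisson process by independent marks. -/
theorem IsPoissonProcess.prob_forall_notMem {Λ : Measure X} (h : IsPoissonProcess P x Λ)
    (hM : ∀ n, Measurable (M n)) (hMi : iIndepFun M P)
    (hxM : IndepFun (fun ω n => x n ω) (fun ω n => M n ω) P) (hA : MeasurableSet A)
    {g : X → ℝ≥0∞} (hg : ∀ n a, P {ω | (a, M n ω) ∈ A} = g a) (hgΛ : ∫⁻ a, g a ∂Λ ≠ ∞) :
    P {ω | ∀ n, (x n ω, M n ω) ∉ A} = ENNReal.ofReal (Real.exp (-(∫⁻ a, g a ∂Λ).toReal)) := by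
  have hgm : Measurable g := by
    have : IsProbabilityMeasure (P.map (M 0)) :=
      Measure.isProbabilityMeasure_map (hM 0).aemeasurable
    -- All marks give the same `g`, so its measurability can be read off from mark `0`.
    have h1 : g = fun a => P.map (M 0) (Prod.mk a ⁻¹' A) := by
      ext a
      rw [Measure.map_apply (hM 0) (measurable_prodMk_left hA), ← hg 0 a]
      rfl
    rw [h1]
    exact measurable_measure_prodMk_left hA
  have hg1 : ∀ a, g a ≤ 1 := fun a => hg 0 a ▸ prob_le_one
  have hgx : ∀ n, Measurable fun ω => g (x n ω) := fun n => hgm.comp (h.measurable n)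
  rw [← h.lintegral_prod hgm hg1 hgΛ,
    lintegral_iInf (f := fun N ω => ∏ n ∈ Finset.range N, (1 - g (x n ω))) (fun N =>
        Finset.measurable_fun_prod _ fun n _ => measurable_const.sub (hgx n))
      (fun i j hij ω => antitone_prod_range_of_le_one (fun n => tsub_le_self) hij) (by simp)]
  simp only [← prob_forall_lt_notMem_eq_lintegral_prod h.measurable hM hMi hxM hA hg]
  have hU : {ω | ∀ n, (x n ω, M n ω) ∉ A} = ⋂ N, {ω | ∀ n < N, (x n ω, M n ω) ∉ A} := by
    ext ω
    simp only [mem_ofPred_eq, mem_iInter]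
    exact ⟨fun h N n _ => h n, fun h n => h (n + 1) n n.lt_succ_self⟩
  rw [hU]
  refine Antitone.measure_iInter (fun i j hij ω hω n hn => hω n (hn.trans_le hij))
    (fun N => MeasurableSet.nullMeasurableSet ?_) ⟨0, measure_ne_top _ _⟩
  have : {ω | ∀ n < N, (x n ω, M n ω) ∉ A} =
      ⋂ n ∈ Finset.range N, (fun ω => (x n ω, M n ω)) ⁻¹' Aᶜ := by
    ext; simp
  rw [this]
  exact Finset.measurableSet_biInter _ fun n _ => ((h.measurable n).prodMk (hM n)) hA.compl

end Marks

/-! ### Independence of disjoint groups -/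

section Groups

variable {Ω ι κ : Type*} [mΩ : MeasurableSpace Ω] {P : Measure Ω}

/-- Induction on the finite set of groups: the new group is disjoint from the union of the earlier
ones, which reduces the step to independence of two groups. -/
theorem iIndep_iSup_of_pairwise_disjoint [IsProbabilityMeasure P] {m : ι → MeasurableSpace Ω}
    (hle : ∀ i, m i ≤ mΩ) (h : iIndep m P) {S : κ → Set ι}
    (hS : Pairwise fun k l => Disjoint (S k) (S l)) : iIndep (fun k => ⨆ i ∈ S k, m i) P := by
  classical
  refine (iIndep_iff _ _).2 fun s => ?_
  induction s using Finset.induction_on with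
  | empty => simp
  | insert k s hk ih =>
    intro t ht
    rw [Finset.set_biInter_insert, Finset.prod_insert hk,
      ← ih fun l hl => ht l (Finset.mem_insert_of_mem hl)]
    have hd : Disjoint (S k) (⋃ l ∈ s, S l) := by
      simp only [Set.disjoint_iUnion_right]
      intro l hl
      exact hS (by rintro rfl; exact hk hl)
    refine (Indep_iff _ _ _).1 (indep_iSup_of_disjoint hle h hd) _ _
      (ht k (Finset.mem_insert_self k s)) ?_
    refine Finset.measurableSet_biInter _ fun l hl => ?_
    refine (iSup₂_le fun i hi => ?_ : (⨆ i ∈ S l, m i) ≤ ⨆ i ∈ ⋃ l ∈ s, S l, m i) _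
      (ht l (Finset.mem_insert_of_mem hl))
    exact le_iSup₂_of_le i (Set.mem_biUnion (by exact hl) hi) le_rfl

/-- The information carried by the variables `f i`, `i ∈ S`. -/
abbrev groupSigma {β : Type*} [MeasurableSpace β] (f : ι → Ω → β) (S : Set ι) :
    MeasurableSpace Ω :=
  ⨆ i ∈ S, MeasurableSpace.comap (f i) inferInstance

variable {β : Type*} [MeasurableSpace β] {f : ι → Ω → β}

theorem measurable_groupSigma {Ω : Type*} {f : ι → Ω → β} {S : Set ι} {i : ι} (hi : i ∈ S) :
    Measurable[groupSigma f S] (f i) :=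
  (comap_measurable (f i)).mono (le_iSup₂_of_le i hi le_rfl) le_rfl

theorem ProbabilityTheory.iIndepFun.of_measurable_groupSigma (hf : ∀ i, Measurable (f i))
    (h : iIndepFun f P)
    {S : κ → Set ι} (hS : Pairwise fun k l => Disjoint (S k) (S l)) {γ : Type*}
    [MeasurableSpace γ] {Y : κ → Ω → γ} (hY : ∀ k, Measurable[groupSigma f (S k)] (Y k)) :
    iIndepFun Y P := by
  have := h.isProbabilityMeasure
  rw [iIndepFun_iff_iIndep] at h ⊢
  have h1 := iIndep_iSup_of_pairwise_disjoint (fun i => (hf i).comap_le) h hS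
  rw [iIndep_iff] at h1 ⊢
  exact fun s t ht => h1 s fun k hk => (hY k).comap_le _ (ht k hk)

theorem ProbabilityTheory.iIndepFun.indepFun_of_measurable_groupSigma (hf : ∀ i, Measurable (f i))
    (h : iIndepFun f P) {S T : Set ι} (hST : Disjoint S T) {γ δ : Type*}
    [MeasurableSpace γ] [MeasurableSpace δ] {Y : Ω → γ} {Z : Ω → δ}
    (hY : Measurable[groupSigma f S] Y) (hZ : Measurable[groupSigma f T] Z) : IndepFun Y Z P := by
  rw [iIndepFun_iff_iIndep] at h
  have h1 := indep_iSup_of_disjoint (fun i => (hf i).comap_le) h hST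
  rw [IndepFun_iff_Indep]
  rw [Indep_iff] at h1 ⊢
  exact fun s t hs ht => h1 s t (hY.comap_le _ hs) (hZ.comap_le _ ht)

end Groups

/-! ### Blockages that meet a path -/

section Geometry

theorem Blockage.mem_body_iff (b : Blockage) (p : Plane) :
    p ∈ b.body ↔ ∃ s ∈ Icc (-1 : ℝ) 1, p = b.midpoint + (s * (b.length / 2)) • b.direction := by
  rw [Blockage.body, segment_eq_image]
  constructor
  · rintro ⟨t, ht, rfl⟩
    exact ⟨2 * t - 1, ⟨by linarith [ht.1], by linarith [ht.2]⟩, by module⟩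
  · rintro ⟨s, hs, rfl⟩
    refine ⟨(s + 1) / 2, ⟨by linarith [hs.1], by linarith [hs.2]⟩, ?_⟩
    simp only
    module

theorem Blockage.not_disjoint_body_iff (b : Blockage) (p q : Plane) :
    ¬ Disjoint b.body (segment ℝ p q) ↔ ∃ s ∈ Icc (-1 : ℝ) 1, ∃ t ∈ Icc (0 : ℝ) 1,
      b.midpoint + (s * (b.length / 2)) • b.direction = p + t • (q - p) := by
  rw [Set.not_disjoint_iff]
  simp only [Blockage.mem_body_iff, segment_eq_image']
  constructor
  · rintro ⟨_, ⟨s, hs, rfl⟩, t, ht, h⟩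
    exact ⟨s, hs, t, ht, h.symm⟩
  · rintro ⟨s, hs, t, ht, h⟩
    exact ⟨_, ⟨s, hs, rfl⟩, t, ht, h.symm⟩

theorem Blockage.continuous_midpoint : Continuous Blockage.midpoint := continuous_fst

theorem Blockage.continuous_length : Continuous Blockage.length :=
  continuous_fst.comp continuous_snd

theorem Blockage.continuous_angle : Continuous Blockage.angle :=
  continuous_fst.comp (continuous_snd.comp continuous_snd)

theorem Blockage.continuous_direction : Continuous Blockage.direction := by
  have := Blockage.continuous_angle
  unfold Blockage.direction
  refine (PiLp.continuous_toLp 2 _).comp (continuous_pi fun i => ?_)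
  fin_cases i <;> simp <;> fun_prop

/-- A closed condition on the two segment parameters and the data is projected along the compact
parameter rectangle. This closedness is the source of measurability of all line-of-sight events. -/
theorem isClosed_not_disjoint_body :
    IsClosed {x : Blockage × Plane × Plane | ¬ Disjoint x.1.body (segment ℝ x.2.1 x.2.2)} := by
  have hc : Continuous fun x : (Icc (-1 : ℝ) 1 × Icc (0 : ℝ) 1) × (Blockage × Plane × Plane) =>
      x.2.1.midpoint + ((x.1.1 : ℝ) * (x.2.1.length / 2)) • x.2.1.direction -
        (x.2.2.1 + (x.1.2 : ℝ) • (x.2.2.2 - x.2.2.1)) := by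
    have h1 := Blockage.continuous_midpoint
    have h2 := Blockage.continuous_length
    have h3 := Blockage.continuous_direction
    fun_prop
  have := isClosedMap_snd_of_compactSpace (X := Icc (-1 : ℝ) 1 × Icc (0 : ℝ) 1) _
    (isClosed_singleton.preimage (t := {(0 : Plane)}) hc)
  convert this using 1
  ext x
  simp only [mem_ofPred_eq, Blockage.not_disjoint_body_iff, mem_image, mem_preimage,
    mem_singleton_iff, sub_eq_zero]
  constructor
  · rintro ⟨s, hs, t, ht, h⟩
    exact ⟨⟨⟨⟨s, hs⟩, ⟨t, ht⟩⟩, x⟩, h, rfl⟩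
  · rintro ⟨⟨⟨⟨s, hs⟩, ⟨t, ht⟩⟩, x⟩, h, rfl⟩
    exact ⟨s, hs, t, ht, h⟩

theorem measurableSet_LoS :
    MeasurableSet {x : (ℕ → Blockage) × Plane × Plane | LoS x.1 x.2.1 x.2.2} := by
  have : {x : (ℕ → Blockage) × Plane × Plane | LoS x.1 x.2.1 x.2.2} =
      ⋂ j, (fun x => (x.1 j, x.2)) ⁻¹'
        {x : Blockage × Plane × Plane | ¬ Disjoint x.1.body (segment ℝ x.2.1 x.2.2)}ᶜ := by
    ext x
    simp [LoS]
  rw [this]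
  exact MeasurableSet.iInter fun j => measurableSet_preimage (by fun_prop)
    isClosed_not_disjoint_body.measurableSet.compl

theorem volume_parallelepiped_plane (v w : Plane) :
    volume (parallelepiped ![v, w]) = ENNReal.ofReal |v 0 * w 1 - v 1 * w 0| := by
  rw [← (EuclideanSpace.basisFun (Fin 2) ℝ).addHaar_eq_volume, Measure.addHaar_parallelepiped,
    Module.Basis.det_apply, Matrix.det_fin_two]
  simp only [Module.Basis.toMatrix_apply, OrthonormalBasis.coe_toBasis_repr_apply]
  simp
  ring_nf

open scoped Pointwise in
/-- The midpoints of the segments of length `l` and angle `θ` that meet a given path form a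
parallelogram. -/
theorem volume_setOf_not_disjoint_body (p q : Plane) (l θ : ℝ) (k : Bool × Bool) :
    volume {m : Plane | ¬ Disjoint (Blockage.body (m, l, θ, k)) (segment ℝ p q)} =
      ENNReal.ofReal (|l| * |(q - p) 0 * Real.sin θ - (q - p) 1 * Real.cos θ|) := by
  set d : Plane := !₂[Real.cos θ, Real.sin θ] with hd
  have : {m : Plane | ¬ Disjoint (Blockage.body (m, l, θ, k)) (segment ℝ p q)} =
      (p - (l / 2) • d) +ᵥ parallelepiped ![q - p, l • d] := by
    ext m
    simp only [mem_ofPred_eq, Blockage.not_disjoint_body_iff, Set.mem_vadd_set,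
      mem_parallelepiped_iff]
    change (∃ s ∈ Icc (-1 : ℝ) 1, ∃ t ∈ Icc (0 : ℝ) 1, m + (s * (l / 2)) • d = p + t • (q - p)) ↔ _
    constructor
    · rintro ⟨s, hs, t, ht, h⟩
      -- The base corner of the parallelogram is the midpoint with `s = 1` and `t = 0`, so `s ∈ [-1,
      -- 1]` is reparametrised as `(1 - s) / 2 ∈ [0, 1]`.
      refine ⟨_, ⟨![t, (1 - s) / 2], ?_, rfl⟩, ?_⟩
      · rw [Set.mem_Icc, Pi.le_def, Pi.le_def]
        simp only [Fin.forall_fin_two]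
        simp
        exact ⟨⟨ht.1, by linarith [hs.2]⟩, ht.2, by linarith [hs.1]⟩
      · rw [eq_sub_of_add_eq h]
        simp only [Fin.sum_univ_two, vadd_eq_add, Matrix.cons_val_zero, Matrix.cons_val_one]
        module
    · rintro ⟨_, ⟨t, ⟨ht0, ht1⟩, rfl⟩, rfl⟩
      refine ⟨1 - 2 * t 1, ⟨?_, ?_⟩, t 0, ⟨ht0 0, ht1 0⟩, ?_⟩
      · have := ht1 1; simp at this; linarith
      · have := ht0 1; simp at this; linarith
      · simp only [Fin.sum_univ_two, vadd_eq_add, Matrix.cons_val_zero, Matrix.cons_val_one]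
        module
  rw [this, measure_vadd, volume_parallelepiped_plane, ← abs_mul]
  congr 2
  simp [hd]
  ring

theorem exists_eq_norm_smul_cos_sin (p : Plane) :
    ∃ α : ℝ, p = ‖p‖ • !₂[Real.cos α, Real.sin α] := by
  have hn : ‖p‖ = ‖(⟨p 0, p 1⟩ : ℂ)‖ := by
    rw [EuclideanSpace.norm_eq, Complex.norm_def, Complex.normSq_mk, Fin.sum_univ_two]
    simp [sq]
  refine ⟨Complex.arg ⟨p 0, p 1⟩, ?_⟩
  ext i
  fin_cases i
  · simp [hn, Complex.norm_mul_cos_arg]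
  · simp [hn, Complex.norm_mul_sin_arg]

theorem norm_cos_sin (r α : ℝ) (hr : 0 ≤ r) : ‖r • (!₂[Real.cos α, Real.sin α] : Plane)‖ = r := by
  rw [norm_smul, EuclideanSpace.norm_eq]
  simp [abs_of_nonneg hr]

end Geometry

/-! ### The laws of the marks -/

section Marks

instance : IsProbabilityMeasure angleLaw :=
  cond_isProbabilityMeasure_of_finite (by simp [Real.pi_pos])
    measure_Ico_lt_top.ne

theorem isProbabilityMeasure_lengthLaw {Lmin Lmax : ℝ} (h : Lmin < Lmax) :
    IsProbabilityMeasure (lengthLaw Lmin Lmax) :=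
  cond_isProbabilityMeasure_of_finite (by simp [h]) (by simp)

instance (Lmin Lmax : ℝ) : SFinite (lengthLaw Lmin Lmax) := by
  unfold lengthLaw ProbabilityTheory.cond; infer_instance

theorem lintegral_angleLaw {f : ℝ → ℝ} (hf : ∀ θ, 0 ≤ f θ)
    (hi : IntervalIntegrable f volume 0 (2 * Real.pi)) :
    ∫⁻ θ, ENNReal.ofReal (f θ) ∂angleLaw =
      ENNReal.ofReal ((2 * Real.pi)⁻¹ * ∫ θ in (0 : ℝ)..2 * Real.pi, f θ) := by
  have hpi := Real.two_pi_pos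
  rw [angleLaw, ProbabilityTheory.cond, lintegral_smul_measure, Real.volume_Ico, sub_zero,
    restrict_Ico_eq_restrict_Ioc, ← ofReal_integral_eq_lintegral_ofReal
      ((intervalIntegrable_iff_integrableOn_Ioc_of_le hpi.le).1 hi)
      (Filter.Eventually.of_forall hf), intervalIntegral.integral_of_le hpi.le, smul_eq_mul,
    ENNReal.ofReal_mul (by positivity : 0 ≤ (2 * Real.pi)⁻¹), ENNReal.ofReal_inv_of_pos hpi]

theorem integral_abs_sin_sub (α : ℝ) : ∫ θ in (0 : ℝ)..2 * Real.pi, |Real.sin (θ - α)| = 4 := by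
  have hper : Function.Periodic (fun θ => |Real.sin θ|) (2 * Real.pi) := fun θ => by simp
  rw [intervalIntegral.integral_comp_sub_right (fun θ => |Real.sin θ|)]
  have h := hper.intervalIntegral_add_eq (0 - α) 0
  rw [show 0 - α + 2 * Real.pi = 2 * Real.pi - α by ring] at h
  have hi : ∀ a b, IntervalIntegrable (fun θ => |Real.sin θ|) volume a b := fun a b =>
    (by fun_prop : Continuous fun θ => |Real.sin θ|).intervalIntegrable a b
  rw [h, zero_add, ← intervalIntegral.integral_add_adjacent_intervals (hi 0 Real.pi) (hi _ _)]
  have h1 : ∫ θ in (0 : ℝ)..Real.pi, |Real.sin θ| = ∫ θ in (0 : ℝ)..Real.pi, Real.sin θ := by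
    refine intervalIntegral.integral_congr fun θ hθ => ?_
    rw [uIcc_of_le Real.pi_pos.le] at hθ
    exact abs_of_nonneg (Real.sin_nonneg_of_mem_Icc hθ)
  have h2 : ∫ θ in Real.pi..2 * Real.pi, |Real.sin θ| =
      ∫ θ in Real.pi..2 * Real.pi, -Real.sin θ := by
    refine intervalIntegral.integral_congr fun θ hθ => ?_
    rw [uIcc_of_le (by linarith [Real.pi_pos])] at hθ
    refine abs_of_nonpos ?_
    have := Real.sin_nonneg_of_mem_Icc (x := θ - Real.pi) ⟨by linarith [hθ.1], by linarith [hθ.2]⟩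
    rw [Real.sin_sub_pi] at this
    linarith
  rw [h1, h2, intervalIntegral.integral_neg, integral_sin, integral_sin]
  norm_num

theorem lintegral_lengthLaw {Lmin Lmax : ℝ} (h0 : 0 ≤ Lmin) :
    ∫⁻ l, ENNReal.ofReal |l| ∂(lengthLaw Lmin Lmax) =
      ENNReal.ofReal (∫ l, l ∂(lengthLaw Lmin Lmax)) := by
  have hmem : ∀ᵐ l ∂(lengthLaw Lmin Lmax), l ∈ Icc Lmin Lmax := ae_cond_mem measurableSet_Icc
  rw [ofReal_integral_eq_lintegral_ofReal]
  · refine lintegral_congr_ae ?_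
    filter_upwards [hmem] with l hl
    rw [abs_of_nonneg (h0.trans hl.1)]
  · have : IntegrableOn (fun l : ℝ => l) (Icc Lmin Lmax) := continuous_id.integrableOn_Icc
    rcases lt_or_ge Lmin Lmax with h | h
    · refine Integrable.smul_measure this ?_
      simp [h]
    -- For `Lmax ≤ Lmin` the interval is null, and conditioning on it yields the zero measure.
    · have h0 : volume (Icc Lmin Lmax) = 0 := by simp [h]
      rw [lengthLaw, cond_eq_zero_of_meas_eq_zero h0]
      exact integrable_zero_measure
  · filter_upwards [hmem] with l hl using h0.trans hl.1

theorem integral_lengthLaw_pos {Lmin Lmax : ℝ} (h0 : 0 ≤ Lmin) (h : Lmin < Lmax) :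
    0 < ∫ l, l ∂(lengthLaw Lmin Lmax) := by
  have hv : (volume (Icc Lmin Lmax)).toReal⁻¹ = (Lmax - Lmin)⁻¹ := by
    rw [Real.volume_Icc, ENNReal.toReal_ofReal (by linarith)]
  rw [lengthLaw, ProbabilityTheory.cond, integral_smul_measure, ENNReal.toReal_inv, hv,
    integral_Icc_eq_integral_Ioc,
    ← intervalIntegral.integral_of_le h.le, integral_id]
  have : 0 < Lmax - Lmin := by linarith
  have : 0 < Lmax ^ 2 - Lmin ^ 2 := by nlinarith
  positivity

end Marks

/-! ### The intensity of the blockages that meet a path -/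

section HitIntensity

variable {lamB Lmin Lmax : ℝ} {μ : unitInterval}

theorem abs_mul_sin_sub_mul_cos (w : Plane) :
    ∃ α, ∀ θ, |w 0 * Real.sin θ - w 1 * Real.cos θ| = ‖w‖ * |Real.sin (θ - α)| := by
  obtain ⟨α, hα⟩ := exists_eq_norm_smul_cos_sin w
  refine ⟨α, fun θ => ?_⟩
  have h0 : w 0 = ‖w‖ * Real.cos α := by conv_lhs => rw [hα]; simp
  have h1 : w 1 = ‖w‖ * Real.sin α := by conv_lhs => rw [hα]; simp
  have habs := abs_mul ‖w‖ (Real.sin (θ - α))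
  rw [abs_norm] at habs
  rw [← habs, h0, h1, Real.sin_sub]
  congr 1
  ring

theorem beta_pos (hlamB : 0 < lamB) (hLmin : 0 ≤ Lmin) (hLmax : Lmin < Lmax) :
    0 < _root_.beta lamB Lmin Lmax := by
  have := integral_lengthLaw_pos hLmin hLmax
  have := Real.pi_pos
  unfold _root_.beta
  positivity

/-- Integrating out the midpoint first leaves a parallelogram area that splits into a factor in the
length and one in the angle. The length averages to `E[L]`, and `|sin|` averages to `4 / (2π) = 2 /
π`. -/
theorem blockageIntensity_not_disjoint_body (hlamB : 0 < lamB) (hLmin : 0 ≤ Lmin)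
    (p q : Plane) :
    blockageIntensity lamB Lmin Lmax μ {b | ¬ Disjoint b.body (segment ℝ p q)} =
      ENNReal.ofReal (_root_.beta lamB Lmin Lmax * dist p q) := by
  have hS : MeasurableSet {b : Blockage | ¬ Disjoint b.body (segment ℝ p q)} :=
    measurableSet_preimage (f := fun b : Blockage => (b, p, q)) (by fun_prop)
      isClosed_not_disjoint_body.measurableSet
  obtain ⟨α, hα⟩ := abs_mul_sin_sub_mul_cos (q - p)
  rw [blockageIntensity, Measure.prod_apply_symm hS]
  have h1 : ∀ x : ℝ × ℝ × Bool × Bool, (ENNReal.ofReal lamB • (volume : Measure Plane))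
      ((fun m => (m, x)) ⁻¹' {b : Blockage | ¬ Disjoint b.body (segment ℝ p q)}) =
      ENNReal.ofReal lamB *
        (ENNReal.ofReal |x.1| * ENNReal.ofReal (‖q - p‖ * |Real.sin (x.2.1 - α)|)) := by
    rintro ⟨l, θ, k⟩
    rw [Measure.smul_apply, smul_eq_mul, ← ENNReal.ofReal_mul (abs_nonneg l), ← hα,
      ← volume_setOf_not_disjoint_body p q l θ k]
    rfl
  simp only [h1]
  rw [lintegral_const_mul _ (by fun_prop), lintegral_prod_mul (f := fun l => ENNReal.ofReal |l|)
    (g := fun y : ℝ × Bool × Bool => ENNReal.ofReal (‖q - p‖ * |Real.sin (y.1 - α)|))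
    (by fun_prop) (by fun_prop), lintegral_prod _ (by fun_prop)]
  simp only [lintegral_const, measure_univ, mul_one]
  rw [lintegral_lengthLaw hLmin, lintegral_angleLaw (fun θ => by positivity)
    (Continuous.intervalIntegrable (by fun_prop) _ _), intervalIntegral.integral_const_mul,
    integral_abs_sin_sub, ← ENNReal.ofReal_mul, ← ENNReal.ofReal_mul hlamB.le, dist_eq_norm',
    _root_.beta]
  · congr 1
    field_simp
    ring
  · refine integral_nonneg_of_ae ?_
    have hmem : ∀ᵐ l ∂(lengthLaw Lmin Lmax), l ∈ Icc Lmin Lmax := ae_cond_mem measurableSet_Icc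
    filter_upwards [hmem] with l hl using hLmin.trans hl.1

theorem PLoS_nonneg (r : ℝ) : 0 ≤ PLoS lamB Lmin Lmax r := (Real.exp_pos _).le

/-- The probability that a path is free of blockages. -/
theorem IsPoissonProcess.prob_LoS {Ω : Type*} [MeasurableSpace Ω] {P : Measure Ω}
    {B : ℕ → Ω → Blockage} (h : IsPoissonProcess P B (blockageIntensity lamB Lmin Lmax μ))
    (hlamB : 0 < lamB) (hLmin : 0 ≤ Lmin) (hLmax : Lmin < Lmax) (p q : Plane) :
    P {ω | LoS (fun k => B k ω) p q} = ENNReal.ofReal (PLoS lamB Lmin Lmax (dist p q)) := by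
  have hS : MeasurableSet {b : Blockage | ¬ Disjoint b.body (segment ℝ p q)} :=
    measurableSet_preimage (f := fun b : Blockage => (b, p, q)) (by fun_prop)
      isClosed_not_disjoint_body.measurableSet
  have hΛ := blockageIntensity_not_disjoint_body (Lmax := Lmax) (μ := μ) hlamB hLmin p q
  -- One set with count `0`: line of sight is a void event of the blockage process.
  have := h.prob_pointCount_eq (ι := Unit)
    (fun _ => {b : Blockage | ¬ Disjoint b.body (segment ℝ p q)}) (fun _ => 0) (fun _ => hS)
    (fun _ => by rw [hΛ]; exact ENNReal.ofReal_ne_top) (fun i j hij => absurd rfl hij)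
  rw [hΛ] at this
  have hb := beta_pos hlamB hLmin hLmax
  have hset : {ω | LoS (fun k => B k ω) p q} = {ω | ∀ _ : Unit, pointCount (fun n => B n ω)
      {b : Blockage | ¬ Disjoint b.body (segment ℝ p q)} = ((0 : ℕ) : ℕ∞)} := by
    ext ω
    simp [LoS, pointCount, Set.eq_empty_iff_forall_notMem]
  rw [hset, this]
  simp [poissonMeasure_singleton, PLoS]
  change
    ENNReal.ofReal (Real.exp (-(ENNReal.ofReal (_root_.beta lamB Lmin Lmax * dist p q)).toReal)) = _
  rw [ENNReal.toReal_ofReal (by positivity)]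

end HitIntensity

/-! ### The orientation of a RIS -/

section Facing

/-- Each condition selects a half-turn, and two half-turns offset by `δ` overlap in a single arc of
length `π - |δ|`. -/
theorem integral_ite_sin_pos {δ : ℝ} (h1 : -Real.pi < δ) (h2 : δ ≤ Real.pi) :
    ∫ θ in (-Real.pi)..Real.pi, (if 0 < Real.sin θ ∧ 0 < Real.sin (θ - δ) then (1 : ℝ) else 0) =
      Real.pi - |δ| := by
  have hpi := Real.pi_pos
  set J : Set ℝ := Ioo (max 0 δ) (min Real.pi (Real.pi + δ)) with hJ
  have hset : ∀ θ ∈ Ioc (-Real.pi) Real.pi,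
      (if 0 < Real.sin θ ∧ 0 < Real.sin (θ - δ) then (1 : ℝ) else 0) = J.indicator 1 θ := by
    intro θ hθ
    have hiff : (0 < Real.sin θ ∧ 0 < Real.sin (θ - δ)) ↔ θ ∈ J := by
      simp only [hJ, mem_Ioo, max_lt_iff, lt_min_iff]
      constructor
      · rintro ⟨hs, ht⟩
        have h0 : 0 < θ := by
          by_contra hn
          exact absurd hs (Real.sin_nonpos_of_nonpos_of_neg_pi_le (not_lt.1 hn) hθ.1.le).not_gt
        have hpi' : θ < Real.pi := lt_of_le_of_ne hθ.2 (by rintro rfl; simp at hs)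
        refine ⟨⟨h0, ?_⟩, hpi', ?_⟩
        · by_contra hn
          exact absurd ht (Real.sin_nonpos_of_nonpos_of_neg_pi_le (by linarith)
            (by linarith)).not_gt
        · by_contra hn
          have := Real.sin_nonneg_of_mem_Icc (x := θ - δ - Real.pi)
            ⟨by linarith, by linarith⟩
          rw [Real.sin_sub_pi] at this
          linarith
      · rintro ⟨⟨h0, hd⟩, hp, hq⟩
        exact ⟨Real.sin_pos_of_pos_of_lt_pi h0 hp,
          Real.sin_pos_of_pos_of_lt_pi (by linarith) (by linarith)⟩
    by_cases h : θ ∈ J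
    · rw [if_pos (hiff.2 h), indicator_of_mem h, Pi.one_apply]
    · rw [if_neg (fun h' => h (hiff.1 h')), indicator_of_notMem h]
  rw [intervalIntegral.integral_of_le (by linarith), setIntegral_congr_fun measurableSet_Ioc hset,
    setIntegral_indicator measurableSet_Ioo]
  have hsub : Ioc (-Real.pi) Real.pi ∩ J = J := by
    refine inter_eq_right.2 fun θ hθ => ⟨?_, ?_⟩
    · have := (le_max_left 0 δ).trans_lt hθ.1; linarith
    · exact (hθ.2.trans_le (min_le_left _ _)).le
  rw [hsub]
  simp only [Pi.one_apply, integral_const, smul_eq_mul, mul_one, MeasurableSet.univ,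
    measureReal_restrict_apply, univ_inter, hJ]
  rw [Real.volume_real_Ioo]
  rcases le_total 0 δ with h | h
  · rw [max_eq_right h, min_eq_left (by linarith), abs_of_nonneg h, max_eq_left (by linarith)]
  · rw [max_eq_left h, min_eq_right (by linarith), abs_of_nonpos h, max_eq_left (by linarith)]
    ring

/-- By periodicity neither the reference direction `α` nor the shift `c` matters. The shift will be
`0` or `π`, according to the side that carries the RIS. -/
theorem integral_ite_sin_sub_pos (α δ c : ℝ) (h1 : -Real.pi < δ) (h2 : δ ≤ Real.pi) :
    ∫ θ in (0 : ℝ)..2 * Real.pi,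
      (if 0 < Real.sin (θ + c - α) ∧ 0 < Real.sin (θ + c - (α + δ)) then (1 : ℝ) else 0) =
      Real.pi - |δ| := by
  set F : ℝ → ℝ := fun θ => if 0 < Real.sin θ ∧ 0 < Real.sin (θ - δ) then (1 : ℝ) else 0
  have hF : Function.Periodic F (2 * Real.pi) := fun θ => by
    simp only [F, Real.sin_add_two_pi, add_sub_right_comm]
  have h3 : ∀ θ : ℝ, (if 0 < Real.sin (θ + c - α) ∧ 0 < Real.sin (θ + c - (α + δ)) then (1 : ℝ)
      else 0) = F (θ + (c - α)) := fun θ => by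
    simp only [F]
    congr 3 <;> ring_nf
  simp only [h3]
  rw [intervalIntegral.integral_comp_add_right F]
  have h := hF.intervalIntegral_add_eq (0 + (c - α)) (-Real.pi)
  rw [show -Real.pi + 2 * Real.pi = Real.pi by ring] at h
  rw [← integral_ite_sin_pos h1 h2, ← h]
  congr 1
  ring

/-- The angle between two vectors is the distance of their directions modulo a full turn. -/
theorem exists_polar_pair {p q : Plane} (hp : p ≠ 0) (hq : q ≠ 0) :
    ∃ α δ : ℝ, -Real.pi < δ ∧ δ ≤ Real.pi ∧ p = ‖p‖ • !₂[Real.cos α, Real.sin α] ∧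
      q = ‖q‖ • !₂[Real.cos (α + δ), Real.sin (α + δ)] ∧ InnerProductGeometry.angle p q = |δ| := by
  obtain ⟨α, hα⟩ := exists_eq_norm_smul_cos_sin p
  obtain ⟨γ, hγ⟩ := exists_eq_norm_smul_cos_sin q
  obtain ⟨h1, h2⟩ := toIocMod_mem_Ioc Real.two_pi_pos (-Real.pi) (γ - α)
  obtain ⟨k, hk⟩ : ∃ k : ℤ,
      toIocMod Real.two_pi_pos (-Real.pi) (γ - α) = γ - α - k * (2 * Real.pi) :=
    ⟨toIocDiv Real.two_pi_pos (-Real.pi) (γ - α), by rw [toIocMod, zsmul_eq_mul]⟩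
  set δ := toIocMod Real.two_pi_pos (-Real.pi) (γ - α)
  have hγδ : α + δ = γ - k * (2 * Real.pi) := by rw [hk]; ring
  have h2' : δ ≤ Real.pi := by linarith
  refine ⟨α, δ, h1, h2', hα, ?_, ?_⟩
  · rw [hγδ, Real.cos_sub_int_mul_two_pi, Real.sin_sub_int_mul_two_pi]
    exact hγ
  · have hcos : Real.cos |δ| = Real.cos (α - γ) := by
      rw [Real.cos_abs, hk, Real.cos_sub_int_mul_two_pi, ← Real.cos_neg, neg_sub]
    rw [InnerProductGeometry.angle]
    have hin : inner ℝ p q = ‖p‖ * ‖q‖ * Real.cos |δ| := by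
      rw [hcos, Real.cos_sub]
      conv_lhs => rw [hα, hγ]
      simp only [PiLp.inner_apply, Fin.sum_univ_two]
      simp
      ring
    have := norm_pos_iff.2 hp
    have := norm_pos_iff.2 hq
    rw [hin, mul_div_cancel_left₀ _ (by positivity),
      Real.arccos_cos (abs_nonneg δ) (abs_le.2 ⟨h1.le, h2'⟩)]

/-- Switching the RIS side reverses the normal, which amounts to turning the blockage by `π`; up to
the positive factor `‖p‖`, facing becomes the sign of a sine. -/
theorem inner_normal_eq (m p : Plane) (l θ α : ℝ) (s k : Bool)
    (hα : p = ‖p‖ • !₂[Real.cos α, Real.sin α]) :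
    inner ℝ (Blockage.normal (m, l, θ, s, k)) p =
      ‖p‖ * if s then Real.sin (θ + Real.pi - α) else Real.sin (θ + 0 - α) := by
  rw [add_sub_right_comm, Real.sin_add_pi, add_zero]
  change inner ℝ ((if s then (1 : ℝ) else -1) • (!₂[-Real.sin θ, Real.cos θ] : Plane)) p = _
  conv_lhs => rw [hα]
  rw [Real.sin_sub]
  cases s <;> simp [PiLp.inner_apply, Fin.sum_univ_two] <;> ring

/-- The probability that a blockage with midpoint `m` carries a RIS that faces `u` and `y`. -/
theorem lintegral_marks_facing (Lmin Lmax : ℝ) [IsProbabilityMeasure (lengthLaw Lmin Lmax)]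
    (μ : unitInterval) {m u y : Plane} (hu : u ≠ m) (hy : y ≠ m) :
    (lengthLaw Lmin Lmax).prod
      (angleLaw.prod ((PMF.uniformOfFintype Bool).toMeasure.prod (bernoulliMeasure true false μ)))
      {x | Blockage.hasRIS (m, x) = true ∧ Facing (m, x) u y} =
    ENNReal.ofReal (μ * (1 / 2 * (1 - 1 / Real.pi *
      InnerProductGeometry.angle (u - m) (y - m)))) := by
  obtain ⟨α, δ, h1, h2, hα, hδ, hang⟩ := exists_polar_pair (sub_ne_zero.2 hu) (sub_ne_zero.2 hy)
  have hpu := norm_pos_iff.2 (sub_ne_zero.2 hu)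
  have hpy := norm_pos_iff.2 (sub_ne_zero.2 hy)
  set F : ℝ → ℝ → ℝ := fun c θ =>
    if 0 < Real.sin (θ + c - α) ∧ 0 < Real.sin (θ + c - (α + δ)) then 1 else 0 with hF
  have hFm : ∀ c, Measurable (F c) := fun c => by
    refine Measurable.ite ?_ measurable_const measurable_const
    have h3 : Measurable fun θ => Real.sin (θ + c - α) := by fun_prop
    have h4 : Measurable fun θ => Real.sin (θ + c - (α + δ)) := by fun_prop
    exact (measurableSet_lt measurable_const h3).inter (measurableSet_lt measurable_const h4)
  have hF0 : ∀ c θ, 0 ≤ F c θ := fun c θ => by simp only [hF]; split_ifs <;> norm_num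
  have hF1 : ∀ c θ, F c θ ≤ 1 := fun c θ => by simp only [hF]; split_ifs <;> norm_num
  have hFint : ∀ c, ∫⁻ θ, ENNReal.ofReal (F c θ) ∂angleLaw =
      ENNReal.ofReal ((2 * Real.pi)⁻¹ * (Real.pi - |δ|)) := fun c => by
    rw [lintegral_angleLaw (hF0 c), integral_ite_sin_sub_pos α δ c h1 h2]
    refine intervalIntegrable_const (c := (1 : ℝ)) |>.mono_fun (hFm c).aestronglyMeasurable ?_
    refine Filter.Eventually.of_forall fun θ => ?_
    simp only [Real.norm_of_nonneg (hF0 c θ), norm_one]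
    exact hF1 c θ
  have hfac : ∀ (l θ : ℝ) (s k : Bool), Facing (m, l, θ, s, k) u y ↔
      0 < Real.sin (θ + (if s then Real.pi else 0) - α) ∧
        0 < Real.sin (θ + (if s then Real.pi else 0) - (α + δ)) := by
    intro l θ s k
    change (0 < inner ℝ (Blockage.normal (m, l, θ, s, k)) (u - m) ∧
      0 < inner ℝ (Blockage.normal (m, l, θ, s, k)) (y - m)) ↔ _
    rw [inner_normal_eq m _ l θ α s k hα, inner_normal_eq m _ l θ (α + δ) s k hδ,
      mul_pos_iff_of_pos_left hpu, mul_pos_iff_of_pos_left hpy]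
    cases s <;> simp
  -- The indicator of the event, written as a product so that the marks can be integrated out one at
  -- a time; it also supplies the measurability of the event.
  set H : ℝ × ℝ × Bool × Bool → ℝ≥0∞ := fun x => (if x.2.2.2 = true then 1 else 0) *
    (if x.2.2.1 = true then ENNReal.ofReal (F Real.pi x.2.1) else ENNReal.ofReal (F 0 x.2.1))
    with hH
  have hHm : Measurable H := by
    have h3 := hFm 0
    have h4 := hFm Real.pi
    refine (Measurable.ite ?_ measurable_const measurable_const).mul
      (Measurable.ite ?_ (by fun_prop) (by fun_prop))
    · exact (measurableSet_singleton true).preimage (by fun_prop)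
    · exact (measurableSet_singleton true).preimage (by fun_prop)
  set S : Set (ℝ × ℝ × Bool × Bool) := {x | Blockage.hasRIS (m, x) = true ∧ Facing (m, x) u y}
  have hSH : ∀ x, S.indicator (fun _ => (1 : ℝ≥0∞)) x = H x := by
    rintro ⟨l, θ, s, k⟩
    have hmem : ((l, θ, s, k) ∈ S) ↔ k = true ∧
      (0 < Real.sin (θ + (if s then Real.pi else 0) - α) ∧
        0 < Real.sin (θ + (if s then Real.pi else 0) - (α + δ))) :=
      and_congr Iff.rfl (hfac l θ s k)
    classical
    rw [indicator_apply]
    simp only [hmem, hH, hF]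
    cases s <;> cases k <;> simp <;> split_ifs <;> simp
  have hSm : MeasurableSet S := by
    have : S = H ⁻¹' {1} := by
      ext x
      rw [mem_preimage, ← hSH, mem_singleton_iff]
      by_cases hx : x ∈ S <;> simp [hx]
    rw [this]
    exact (measurableSet_singleton 1).preimage hHm
  rw [← lintegral_indicator_one hSm]
  change ∫⁻ x, S.indicator (fun _ => (1 : ℝ≥0∞)) x ∂_ = _
  simp only [hSH]
  rw [lintegral_prod _ hHm.aemeasurable]
  have hb1 : (bernoulliMeasure true false μ) {true} = ENNReal.ofReal μ := by
    rw [bernoulliMeasure_apply _ (measurableSet_singleton true)]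
    simp only [mem_singleton_iff, if_true, Bool.false_eq_true, if_false]
    rw [← ENNReal.ofReal_coe_nnreal]
    rfl
  have hu1 : ∀ s, (PMF.uniformOfFintype Bool).toMeasure {s} = ENNReal.ofReal (1 / 2) := fun s => by
    rw [PMF.toMeasure_apply_singleton _ _ (measurableSet_singleton s)]
    simp
  have hin : ∀ l, ∫⁻ z, H (l, z) ∂(angleLaw.prod
      ((PMF.uniformOfFintype Bool).toMeasure.prod (bernoulliMeasure true false μ))) =
      ENNReal.ofReal (μ * (1 / 2 * (1 - 1 / Real.pi * |δ|))) := by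
    intro l
    rw [lintegral_prod (fun z => H (l, z)) (hHm.comp measurable_prodMk_left).aemeasurable]
    have hin2 : ∀ θ, ∫⁻ z, H (l, θ, z)
        ∂((PMF.uniformOfFintype Bool).toMeasure.prod (bernoulliMeasure true false μ)) =
        ENNReal.ofReal (μ / 2) * ENNReal.ofReal (F Real.pi θ) +
          ENNReal.ofReal (μ / 2) * ENNReal.ofReal (F 0 θ) := by
      intro θ
      rw [lintegral_prod (fun z => H (l, θ, z)) (measurable_of_countable _).aemeasurable]
      simp only [lintegral_fintype, Fintype.univ_bool, hu1, hH]
      simp [hb1]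
      rw [ENNReal.ofReal_div_of_pos two_pos, div_eq_mul_inv, ENNReal.ofReal_ofNat]
      ring
    simp only [hin2]
    have h3 := hFm 0
    have h4 := hFm Real.pi
    rw [lintegral_add_left (by fun_prop), lintegral_const_mul _ (by fun_prop),
      lintegral_const_mul _ (by fun_prop), hFint, hFint, ← two_mul,
      ← ENNReal.ofReal_mul (by linarith [μ.2.1]), ← ENNReal.ofReal_ofNat,
      ← ENNReal.ofReal_mul (by norm_num)]
    congr 1
    field_simp
  simp only [hin, lintegral_const, measure_univ, mul_one, hang]

end Facing

/-! ### The integrals over the plane -/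

section Integrals

variable {lamB Lmin Lmax : ℝ} {μ : unitInterval}

theorem integrable_PLoS_norm (hb : 0 < _root_.beta lamB Lmin Lmax) :
    Integrable fun z : Plane => PLoS lamB Lmin Lmax ‖z‖ := by
  rw [integrable_fun_norm_addHaar]
  have := integrableOn_rpow_mul_exp_neg_mul_rpow (s := 1) (p := 1) (by norm_num) one_pos hb
  simp only [finrank_euclideanSpace, Fintype.card_fin]
  simpa [PLoS] using this

theorem measurable_PLoS : Measurable (PLoS lamB Lmin Lmax) := by
  unfold PLoS; fun_prop

theorem PLoS_le_one (hb : 0 < _root_.beta lamB Lmin Lmax) {r : ℝ} (hr : 0 ≤ r) :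
    PLoS lamB Lmin Lmax r ≤ 1 := by
  unfold PLoS
  exact Real.exp_le_one_iff.2 (by nlinarith)

/-- The density, at the point `m` of the plane, of the RISs that provide an indirect path between
`u` and `y`. -/
noncomputable def servingDensity (lamB Lmin Lmax : ℝ) (u y m : Plane) : ℝ :=
  PLoS lamB Lmin Lmax (dist m u) * PLoS lamB Lmin Lmax (dist m y) *
    (1 / 2 * (1 - 1 / Real.pi * InnerProductGeometry.angle (u - m) (y - m)))

theorem orientation_mem_Icc {x : ℝ} (h0 : 0 ≤ x) (h1 : x ≤ Real.pi) :
    1 / 2 * (1 - 1 / Real.pi * x) ∈ Icc (0 : ℝ) (1 / 2) := by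
  have hpi := Real.pi_pos
  have h2 : 1 / Real.pi * x ≤ 1 := by rw [one_div_mul_eq_div]; exact (div_le_one hpi).2 h1
  have h3 : 0 ≤ 1 / Real.pi * x := by positivity
  constructor <;> linarith

theorem servingDensity_nonneg (u y m : Plane) : 0 ≤ servingDensity lamB Lmin Lmax u y m :=
  mul_nonneg (mul_nonneg (PLoS_nonneg _) (PLoS_nonneg _))
    (orientation_mem_Icc (InnerProductGeometry.angle_nonneg _ _)
      (InnerProductGeometry.angle_le_pi _ _)).1

theorem servingDensity_le (u y m : Plane) : servingDensity lamB Lmin Lmax u y m ≤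
    PLoS lamB Lmin Lmax (dist m u) * PLoS lamB Lmin Lmax (dist m y) :=
  mul_le_of_le_one_right (mul_nonneg (PLoS_nonneg _) (PLoS_nonneg _))
    ((orientation_mem_Icc (InnerProductGeometry.angle_nonneg _ _)
      (InnerProductGeometry.angle_le_pi _ _)).2.trans (by norm_num))

theorem measurable_servingDensity (u y : Plane) :
    Measurable (servingDensity lamB Lmin Lmax u y) := by
  have := measurable_PLoS (lamB := lamB) (Lmin := Lmin) (Lmax := Lmax)
  unfold servingDensity InnerProductGeometry.angle
  have h2 := Real.measurable_arccos
  fun_prop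

theorem integrable_servingDensity (hb : 0 < _root_.beta lamB Lmin Lmax) (u y : Plane) :
    Integrable (servingDensity lamB Lmin Lmax u y) := by
  have h1 : Integrable fun m : Plane => PLoS lamB Lmin Lmax (dist m u) := by
    simp only [dist_eq_norm]
    exact (integrable_PLoS_norm hb).comp_sub_right u
  refine h1.mono' (measurable_servingDensity u y).aestronglyMeasurable
    (Filter.Eventually.of_forall fun m => ?_)
  rw [Real.norm_of_nonneg (servingDensity_nonneg u y m)]
  exact (servingDensity_le u y m).trans
    (mul_le_of_le_one_right (PLoS_nonneg _) (PLoS_le_one hb dist_nonneg))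

/-- Puts the base station on the nonnegative real axis, so that the polar angle `φ` of a RIS is
measured from the direction of the base station. The case `v = 0` is included. -/
theorem exists_linearIsometryEquiv_complex (v : Plane) :
    ∃ Φ : ℂ ≃ₗᵢ[ℝ] Plane, Φ (‖v‖ : ℂ) = v := by
  obtain ⟨e, he, hev⟩ : ∃ e : Plane, ‖e‖ = 1 ∧ v = ‖v‖ • e := by
    obtain ⟨α, hα⟩ := exists_eq_norm_smul_cos_sin v
    exact ⟨_, by simpa using norm_cos_sin 1 α zero_le_one, hα⟩
  obtain ⟨b, hb⟩ := Orthonormal.exists_orthonormalBasis_extension_of_card_eq (𝕜 := ℝ) (E := Plane)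
    (ι := Fin 2) (by simp) (v := fun _ => e) (s := {0}) (by
      refine ⟨fun i => he, fun i j hij => absurd (Subsingleton.elim i j) hij⟩)
  refine ⟨Complex.isometryOfOrthonormal b, ?_⟩
  rw [Complex.isometryOfOrthonormal_apply, hb 0 rfl]
  simp [← hev]

/-- With `w = t * exp (i φ)`, the law of cosines gives `‖r - w‖`, and the inner product of `-w` and
`r - w` is `t * (t - r * cos φ)`. Positivity of `t` allows it to cancel inside the arccosine. -/
theorem servingDensity_polar {Φ : ℂ ≃ₗᵢ[ℝ] Plane} {u y : Plane} (hΦ : Φ (dist u y : ℂ) = y - u)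
    {t : ℝ} (ht : 0 < t) (φ : ℝ) :
    servingDensity lamB Lmin Lmax u y (u + Φ (t * (Real.cos φ + Real.sin φ * Complex.I))) =
      reflectionProb lamB Lmin Lmax (dist u y) t φ := by
  set r := dist u y
  set w : ℂ := t * (Real.cos φ + Real.sin φ * Complex.I) with hw
  have hre : w.re = t * Real.cos φ := by simp [hw, -Complex.ofReal_cos, -Complex.ofReal_sin]
  have him : w.im = t * Real.sin φ := by simp [hw, -Complex.ofReal_cos, -Complex.ofReal_sin]
  have hsq := Real.sin_sq_add_cos_sq φ
  have hnw : ‖w‖ = t := by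
    have : w.re * w.re + w.im * w.im = t ^ 2 := by
      rw [hre, him]
      linear_combination t ^ 2 * hsq
    rw [Complex.norm_def, Complex.normSq_apply, this, Real.sqrt_sq ht.le]
  have hnr : ‖(r : ℂ) - w‖ = √(r ^ 2 + t ^ 2 - 2 * r * t * Real.cos φ) := by
    rw [Complex.norm_def, Complex.normSq_apply]
    congr 1
    simp only [Complex.sub_re, Complex.sub_im, Complex.ofReal_re, Complex.ofReal_im, hre, him]
    linear_combination t ^ 2 * hsq
  have hy : y = u + Φ r := by rw [hΦ]; abel
  have hin : inner ℝ (-w) ((r : ℂ) - w) = t * (t - r * Real.cos φ) := by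
    rw [Complex.inner]
    simp [hre, him]
    linear_combination t ^ 2 * hsq
  have h1 : dist (u + Φ w) u = t := by rw [dist_eq_norm, add_sub_cancel_left, Φ.norm_map, hnw]
  have h2 : y - (u + Φ w) = Φ (r - w) := by rw [map_sub, hy]; abel
  have h3 : u - (u + Φ w) = Φ (-w) := by rw [map_neg]; abel
  have h4 : dist (u + Φ w) y = √(r ^ 2 + t ^ 2 - 2 * r * t * Real.cos φ) := by
    rw [dist_eq_norm', h2, Φ.norm_map, hnr]
  rw [servingDensity, h1, h4, h2, h3, reflectionProb, orientationProb, InnerProductGeometry.angle,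
    Φ.norm_map, Φ.norm_map, Φ.inner_map_map, hin, norm_neg, hnw, hnr,
    mul_div_mul_left _ _ ht.ne', add_comm (t ^ 2) (r ^ 2)]
  ring

theorem integral_servingDensity (hb : 0 < _root_.beta lamB Lmin Lmax) (u y : Plane) :
    ∫ m, servingDensity lamB Lmin Lmax u y m =
      ∫ φ in (-Real.pi)..Real.pi, ∫ t in Ioi (0 : ℝ),
        reflectionProb lamB Lmin Lmax (dist u y) t φ * t := by
  obtain ⟨Φ, hΦ⟩ := exists_linearIsometryEquiv_complex (y - u)
  rw [← dist_eq_norm'] at hΦ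
  have hmp : MeasurePreserving fun w : ℂ => u + Φ w :=
    (measurePreserving_add_left volume u).comp Φ.measurePreserving
  have hme : MeasurableEmbedding fun w : ℂ => u + Φ w :=
    (measurableEmbedding_addLeft u).comp Φ.toHomeomorph.measurableEmbedding
  have hcongr : ∀ p ∈ polarCoord.target,
      p.1 • servingDensity lamB Lmin Lmax u y (u + Φ (Complex.polarCoord.symm p)) =
        reflectionProb lamB Lmin Lmax (dist u y) p.1 p.2 * p.1 := by
    rintro ⟨t, φ⟩ hp
    rw [Complex.polarCoord_symm_apply, servingDensity_polar hΦ hp.1, smul_eq_mul, mul_comm]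
  have hcongr' : ∀ p ∈ polarCoord.target, ENNReal.ofReal p.1 •
      ENNReal.ofReal (servingDensity lamB Lmin Lmax u y (u + Φ (Complex.polarCoord.symm p))) =
        ENNReal.ofReal (reflectionProb lamB Lmin Lmax (dist u y) p.1 p.2 * p.1) := by
    intro p hp
    rw [← hcongr p hp, smul_eq_mul, smul_eq_mul, ENNReal.ofReal_mul (le_of_lt hp.1)]
  have hm : Measurable fun p : ℝ × ℝ =>
      reflectionProb lamB Lmin Lmax (dist u y) p.1 p.2 * p.1 := by
    have := measurable_PLoS (lamB := lamB) (Lmin := Lmin) (Lmax := Lmax)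
    have h2 := Real.measurable_arccos
    unfold reflectionProb orientationProb
    fun_prop
  have hnn : ∀ p ∈ polarCoord.target,
      0 ≤ reflectionProb lamB Lmin Lmax (dist u y) p.1 p.2 * p.1 := by
    intro p hp
    rw [← hcongr p hp]
    exact smul_nonneg (le_of_lt hp.1) (servingDensity_nonneg _ _ _)
  have htm : MeasurableSet polarCoord.target := polarCoord.open_target.measurableSet
  -- Fubini needs integrability in polar coordinates, which is carried over from the plane by the
  -- change of variables for `lintegral`.
  have hint : IntegrableOn (fun p : ℝ × ℝ =>
      reflectionProb lamB Lmin Lmax (dist u y) p.1 p.2 * p.1) polarCoord.target := by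
    refine ⟨hm.aestronglyMeasurable, ?_⟩
    rw [hasFiniteIntegral_iff_ofReal ((ae_restrict_iff' htm).2 (Filter.Eventually.of_forall hnn)),
      ← setLIntegral_congr_fun htm hcongr', Complex.lintegral_comp_polarCoord_symm
        (fun w => ENNReal.ofReal (servingDensity lamB Lmin Lmax u y (u + Φ w)))]
    have := hmp.integrable_comp_emb hme |>.2 (integrable_servingDensity hb u y)
    exact (hasFiniteIntegral_iff_ofReal (Filter.Eventually.of_forall fun _ =>
      servingDensity_nonneg _ _ _)).1 this.2
  rw [← hmp.integral_comp hme, ← Complex.integral_comp_polarCoord_symm,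
    setIntegral_congr_fun htm hcongr, polarCoord_target]
  rw [polarCoord_target] at hint
  rw [intervalIntegral.integral_of_le (by linarith [Real.pi_pos]), integral_Ioc_eq_integral_Ioo]
  rw [IntegrableOn, Measure.volume_eq_prod, ← Measure.prod_restrict] at hint
  rw [Measure.volume_eq_prod, ← Measure.prod_restrict, integral_prod_symm _ hint]

theorem measurable_PI : Measurable (PI lamB Lmin Lmax μ) := by
  have h1 : Measurable fun p : (ℝ × ℝ) × ℝ =>
      reflectionProb lamB Lmin Lmax p.1.1 p.2 p.1.2 * p.2 := by
    have := measurable_PLoS (lamB := lamB) (Lmin := Lmin) (Lmax := Lmax)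
    have h2 := Real.measurable_arccos
    unfold reflectionProb orientationProb
    fun_prop
  have h2 : StronglyMeasurable fun p : ℝ × ℝ => ∫ t in Ioi (0 : ℝ),
      reflectionProb lamB Lmin Lmax p.1 t p.2 * t :=
    h1.stronglyMeasurable.integral_prod_right (ν := volume.restrict (Ioi (0 : ℝ)))
  have h3 : StronglyMeasurable fun r : ℝ => ∫ φ in Ioc (-Real.pi) Real.pi, ∫ t in Ioi (0 : ℝ),
      reflectionProb lamB Lmin Lmax r t φ * t :=
    h2.integral_prod_right (ν := volume.restrict (Ioc (-Real.pi) Real.pi))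
  have h4 := h3.measurable
  have : PI lamB Lmin Lmax μ = fun r => 1 - Real.exp (-((μ : ℝ) * lamB *
      ∫ φ in Ioc (-Real.pi) Real.pi, ∫ t in Ioi (0 : ℝ),
        reflectionProb lamB Lmin Lmax r t φ * t)) := by
    ext r
    rw [PI, intervalIntegral.integral_of_le (by linarith [Real.pi_pos])]
  rw [this]
  fun_prop

theorem PI_dist (hb : 0 < _root_.beta lamB Lmin Lmax) (u y : Plane) :
    PI lamB Lmin Lmax μ (dist u y) =
      1 - Real.exp (-((μ : ℝ) * lamB * ∫ m, servingDensity lamB Lmin Lmax u y m)) := by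
  rw [integral_servingDensity hb, PI]

theorem PI_dist_mem_Icc (hb : 0 < _root_.beta lamB Lmin Lmax) (hlamB : 0 < lamB) (u y : Plane) :
    PI lamB Lmin Lmax μ (dist u y) ∈ Icc (0 : ℝ) 1 := by
  have h1 : 0 ≤ ∫ m, servingDensity lamB Lmin Lmax u y m :=
    integral_nonneg (servingDensity_nonneg u y)
  have h2 := mul_nonneg (mul_nonneg μ.2.1 hlamB.le) h1
  rw [PI_dist hb]
  have := Real.exp_pos (-((μ : ℝ) * lamB * ∫ m, servingDensity lamB Lmin Lmax u y m))
  have := Real.exp_le_one_iff.2 (neg_nonpos.2 h2)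
  constructor <;> linarith

/-- The inequality `1 - exp (-x) ≤ x` makes the bound linear in the serving density, so that Tonelli
can be applied over base station positions. -/
theorem PI_dist_le (hb : 0 < _root_.beta lamB Lmin Lmax) (u y : Plane) :
    PI lamB Lmin Lmax μ (dist u y) ≤
      (μ : ℝ) * lamB * ∫ m, servingDensity lamB Lmin Lmax u y m := by
  rw [PI_dist hb]
  have := Real.add_one_le_exp (-((μ : ℝ) * lamB * ∫ m, servingDensity lamB Lmin Lmax u y m))
  linarith

theorem measurable_Pv : Measurable (Pv lamB Lmin Lmax μ) := by
  have h1 := measurable_PLoS (lamB := lamB) (Lmin := Lmin) (Lmax := Lmax)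
  have h2 := measurable_PI (lamB := lamB) (Lmin := Lmin) (Lmax := Lmax) (μ := μ)
  unfold Pv PNLoS
  fun_prop

theorem Pv_norm_bounds (hb : 0 < _root_.beta lamB Lmin Lmax) (hlamB : 0 < lamB) (y : Plane) :
    0 ≤ Pv lamB Lmin Lmax μ ‖y‖ ∧ Pv lamB Lmin Lmax μ ‖y‖ ≤
      PLoS lamB Lmin Lmax ‖y‖ + (μ : ℝ) * lamB * ∫ m, servingDensity lamB Lmin Lmax 0 y m := by
  have h1 := PI_dist_mem_Icc (μ := μ) hb hlamB 0 y
  have h2 := PI_dist_le (μ := μ) hb 0 y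
  have h3 := PLoS_nonneg (lamB := lamB) (Lmin := Lmin) (Lmax := Lmax) ‖y‖
  have h4 := PLoS_le_one hb (norm_nonneg y)
  rw [dist_zero_left] at h1 h2
  unfold Pv PNLoS
  constructor
  · have := mul_nonneg (sub_nonneg.2 h4) h1.1
    linarith
  · nlinarith [h1.1, mul_nonneg h3 h1.1]

/-- Dropping the orientation factor leaves the convolution of `PLoS ‖·‖` with itself, whose total
mass is the square of a finite integral. -/
theorem lintegral_lintegral_servingDensity_ne_top (hb : 0 < _root_.beta lamB Lmin Lmax) :
    ∫⁻ y, ∫⁻ m, ENNReal.ofReal (servingDensity lamB Lmin Lmax 0 y m) ≠ ∞ := by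
  have hP := measurable_PLoS (lamB := lamB) (Lmin := Lmin) (Lmax := Lmax)
  have hfin : ∫⁻ z : Plane, ENNReal.ofReal (PLoS lamB Lmin Lmax ‖z‖) ≠ ∞ :=
    ((hasFiniteIntegral_iff_ofReal (Filter.Eventually.of_forall fun _ => PLoS_nonneg _)).1
      (integrable_PLoS_norm hb).2).ne
  refine ne_top_of_le_ne_top (ENNReal.mul_ne_top hfin hfin) ?_
  calc ∫⁻ y, ∫⁻ m, ENNReal.ofReal (servingDensity lamB Lmin Lmax 0 y m)
      ≤ ∫⁻ y : Plane, ∫⁻ m : Plane, ENNReal.ofReal (PLoS lamB Lmin Lmax ‖m‖) *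
          ENNReal.ofReal (PLoS lamB Lmin Lmax ‖y - m‖) := by
        refine lintegral_mono fun y => lintegral_mono fun m => ?_
        rw [← ENNReal.ofReal_mul (PLoS_nonneg _)]
        refine ENNReal.ofReal_le_ofReal ?_
        have := servingDensity_le (lamB := lamB) (Lmin := Lmin) (Lmax := Lmax) 0 y m
        rwa [dist_zero_right, dist_eq_norm'] at this
    _ = ∫⁻ m : Plane, ∫⁻ y : Plane, ENNReal.ofReal (PLoS lamB Lmin Lmax ‖m‖) *
          ENNReal.ofReal (PLoS lamB Lmin Lmax ‖y - m‖) :=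
        lintegral_lintegral_swap (by unfold Function.uncurry; fun_prop)
    _ = ∫⁻ m : Plane, ENNReal.ofReal (PLoS lamB Lmin Lmax ‖m‖) *
          ∫⁻ z : Plane, ENNReal.ofReal (PLoS lamB Lmin Lmax ‖z‖) := by
        refine lintegral_congr fun m => ?_
        rw [lintegral_const_mul _ (by fun_prop)]
        congr 1
        exact lintegral_sub_right_eq_self
          (fun z : Plane => ENNReal.ofReal (PLoS lamB Lmin Lmax ‖z‖)) m
    _ = _ := lintegral_mul_const _ (by fun_prop)

theorem integrable_Pv_norm (hb : 0 < _root_.beta lamB Lmin Lmax) (hlamB : 0 < lamB) :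
    Integrable fun y : Plane => Pv lamB Lmin Lmax μ ‖y‖ := by
  have hP := measurable_PLoS (lamB := lamB) (Lmin := Lmin) (Lmax := Lmax)
  refine ⟨(measurable_Pv.comp measurable_norm).aestronglyMeasurable, ?_⟩
  rw [hasFiniteIntegral_iff_ofReal (Filter.Eventually.of_forall fun y =>
    (Pv_norm_bounds hb hlamB y).1)]
  have hfin : ∫⁻ z : Plane, ENNReal.ofReal (PLoS lamB Lmin Lmax ‖z‖) ≠ ∞ :=
    ((hasFiniteIntegral_iff_ofReal (Filter.Eventually.of_forall fun _ => PLoS_nonneg _)).1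
      (integrable_PLoS_norm hb).2).ne
  refine lt_of_le_of_lt (b := (∫⁻ z : Plane, ENNReal.ofReal (PLoS lamB Lmin Lmax ‖z‖)) +
    ENNReal.ofReal ((μ : ℝ) * lamB) *
      ∫⁻ y, ∫⁻ m, ENNReal.ofReal (servingDensity lamB Lmin Lmax 0 y m)) ?_
    (ENNReal.add_lt_top.2 ⟨hfin.lt_top, ENNReal.mul_lt_top ENNReal.ofReal_lt_top
      (lintegral_lintegral_servingDensity_ne_top hb).lt_top⟩)
  rw [← lintegral_const_mul' _ _ ENNReal.ofReal_ne_top, ← lintegral_add_left (by fun_prop)]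
  refine lintegral_mono fun y => ?_
  rw [← ofReal_integral_eq_lintegral_ofReal (integrable_servingDensity hb 0 y)
    (Filter.Eventually.of_forall (servingDensity_nonneg 0 y)),
    ← ENNReal.ofReal_mul (mul_nonneg μ.2.1 hlamB.le), ← ENNReal.ofReal_add (PLoS_nonneg _)
      (mul_nonneg (mul_nonneg μ.2.1 hlamB.le) (integral_nonneg (servingDensity_nonneg 0 y)))]
  exact ENNReal.ofReal_le_ofReal (Pv_norm_bounds hb hlamB y).2

theorem integrableOn_Pv (lamBS : ℝ) (hb : 0 < _root_.beta lamB Lmin Lmax) (hlamB : 0 < lamB) :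
    IntegrableOn (fun r => lamBS * Pv lamB Lmin Lmax μ r * r) (Ioi 0) := by
  have h := integrable_Pv_norm (μ := μ) hb hlamB
  rw [integrable_fun_norm_addHaar] at h
  simp only [finrank_euclideanSpace, Fintype.card_fin, Nat.add_one_sub_one, pow_one,
    smul_eq_mul] at h
  refine (Integrable.congr (h.const_mul lamBS) (Filter.Eventually.of_forall fun r => ?_))
  simp only
  ring

/-- Translation moves the user to the origin. The factor `2π` of the radial integral arises as the
dimension `2` times the area `π` of the unit disc. -/
theorem lintegral_Pv_dist {lamBS : ℝ} (hlamBS : 0 < lamBS)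
    (hb : 0 < _root_.beta lamB Lmin Lmax) (hlamB : 0 < lamB) (u : Plane) :
    ∫⁻ y, ENNReal.ofReal (Pv lamB Lmin Lmax μ (dist u y))
      ∂(ENNReal.ofReal lamBS • (volume : Measure Plane)) =
    ENNReal.ofReal (2 * Real.pi * ∫ r in Ioi (0 : ℝ), lamBS * Pv lamB Lmin Lmax μ r * r) := by
  simp only [dist_eq_norm']
  rw [lintegral_smul_measure, lintegral_sub_right_eq_self
      (fun z : Plane => ENNReal.ofReal (Pv lamB Lmin Lmax μ ‖z‖)) u,
    ← ofReal_integral_eq_lintegral_ofReal (integrable_Pv_norm hb hlamB)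
      (Filter.Eventually.of_forall fun y => (Pv_norm_bounds hb hlamB y).1),
    integral_fun_norm_addHaar, smul_eq_mul, ← ENNReal.ofReal_mul hlamBS.le, measureReal_def,
    EuclideanSpace.volume_ball_fin_two]
  simp only [finrank_euclideanSpace, Fintype.card_fin, Nat.add_one_sub_one, pow_one, smul_eq_mul,
    ENNReal.ofReal_one, one_pow, one_mul, ENNReal.toReal_ofReal Real.pi_pos.le, nsmul_eq_mul,
    Nat.cast_ofNat]
  congr 1
  have : ∀ r, lamBS * Pv lamB Lmin Lmax μ r * r = lamBS * (r * Pv lamB Lmin Lmax μ r) :=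
    fun r => by ring
  simp only [this, integral_const_mul]
  ring

end Integrals

/-! ### Line-of-sight events -/

set_option synthInstance.maxSize 1000

section Events

theorem Blockage.measurable_normal : Measurable Blockage.normal := by
  have h1 : Measurable fun b : Blockage => (if b.side = true then (1 : ℝ) else -1) :=
    Measurable.ite ((measurableSet_singleton true).preimage (by unfold Blockage.side; fun_prop))
      measurable_const measurable_const
  have h2 : Measurable fun b : Blockage => (!₂[-Real.sin b.angle, Real.cos b.angle] : Plane) := by
    have := Blockage.continuous_angle
    refine Continuous.measurable ((PiLp.continuous_toLp 2 _).comp (continuous_pi fun i => ?_))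
    fin_cases i <;> simp <;> fun_prop
  exact h1.smul h2

/-- The blockages seen by the two hops through a RIS. -/
abbrev Hop : Type := (ℕ → Blockage) × (ℕ → Blockage)

/-- The RIS on the blockage `b` gives an indirect path between `u` and `y`. -/
def Serves (u y : Plane) (b : Blockage) (h : Hop) : Prop :=
  b.hasRIS = true ∧ LoS h.1 b.midpoint u ∧ LoS h.2 b.midpoint y ∧ Facing b u y

theorem measurableSet_hasRIS_and_facing (u : Plane) :
    MeasurableSet {x : Plane × Blockage | x.2.hasRIS = true ∧ Facing x.2 u x.1} := by
  have hn := Blockage.measurable_normal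
  have hm := Blockage.continuous_midpoint.measurable
  have h0 : Measurable fun x : Plane × Blockage => x.2.hasRIS := by
    unfold Blockage.hasRIS; fun_prop
  have h1 : Measurable fun x : Plane × Blockage => inner ℝ x.2.normal (u - x.2.midpoint) := by
    fun_prop
  have h2 : Measurable fun x : Plane × Blockage => inner ℝ x.2.normal (x.1 - x.2.midpoint) := by
    fun_prop
  exact ((measurableSet_singleton true).preimage h0).inter
    ((measurableSet_lt measurable_const h1).inter (measurableSet_lt measurable_const h2))

theorem measurableSet_serves (u : Plane) :
    MeasurableSet {x : Plane × Blockage × Hop | Serves u x.1 x.2.1 x.2.2} := by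
  have hm := Blockage.continuous_midpoint.measurable
  have h1 := measurableSet_LoS.preimage
    (f := fun x : Plane × Blockage × Hop => (x.2.2.1, x.2.1.midpoint, u)) (by fun_prop)
  have h2 := measurableSet_LoS.preimage
    (f := fun x : Plane × Blockage × Hop => (x.2.2.2, x.2.1.midpoint, x.1)) (by fun_prop)
  have h3 := (measurableSet_hasRIS_and_facing u).preimage
    (f := fun x : Plane × Blockage × Hop => (x.1, x.2.1)) (by fun_prop)
  convert h3.inter (h1.inter h2) using 1
  ext x
  simp only [Serves, mem_ofPred_eq, mem_inter_iff, mem_preimage]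
  tauto

theorem measurableSet_exists_serves (u : Plane) :
    MeasurableSet {x : Plane × (ℕ → Blockage) × (ℕ → Hop) |
      ∃ j, Serves u x.1 (x.2.1 j) (x.2.2 j)} := by
  have : {x : Plane × (ℕ → Blockage) × (ℕ → Hop) | ∃ j, Serves u x.1 (x.2.1 j) (x.2.2 j)} =
      ⋃ j, (fun x => (x.1, x.2.1 j, x.2.2 j)) ⁻¹'
        {x : Plane × Blockage × Hop | Serves u x.1 x.2.1 x.2.2} := by
    ext x; simp
  rw [this]
  exact MeasurableSet.iUnion fun j => (measurableSet_serves u).preimage (by fun_prop)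

open Classical in
-- The left integrand is the retention probability in the thinning of the carriers; the marks are
-- integrated out at a fixed midpoint.
theorem lintegral_blockageIntensity_facing {lamB Lmin Lmax : ℝ} (μ : unitInterval)
    (hlamB : 0 < lamB) (hLmin : 0 ≤ Lmin) (hLmax : Lmin < Lmax) (u y : Plane) :
    ∫⁻ b, (if b.hasRIS = true ∧ Facing b u y then
      ENNReal.ofReal (PLoS lamB Lmin Lmax (dist b.midpoint u) *
        PLoS lamB Lmin Lmax (dist b.midpoint y)) else 0) ∂(blockageIntensity lamB Lmin Lmax μ) =
      ENNReal.ofReal (μ * lamB * ∫ m, servingDensity lamB Lmin Lmax u y m) := by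
  have hb := beta_pos hlamB hLmin hLmax
  have := isProbabilityMeasure_lengthLaw hLmax
  have hP := measurable_PLoS (lamB := lamB) (Lmin := Lmin) (Lmax := Lmax)
  have hm := Blockage.continuous_midpoint.measurable
  have hS : MeasurableSet {b : Blockage | b.hasRIS = true ∧ Facing b u y} :=
    (measurableSet_hasRIS_and_facing u).preimage (f := fun b : Blockage => (y, b)) (by fun_prop)
  have hg : Measurable fun b : Blockage => (if b.hasRIS = true ∧ Facing b u y then
      ENNReal.ofReal (PLoS lamB Lmin Lmax (dist b.midpoint u) *
        PLoS lamB Lmin Lmax (dist b.midpoint y)) else 0) :=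
    Measurable.ite hS (by fun_prop) measurable_const
  rw [blockageIntensity, lintegral_prod _ hg.aemeasurable, lintegral_smul_measure]
  -- At `m = u` or `m = y` facing fails, while the angle with the zero vector has the default value
  -- `π / 2`; the formula holds only off this null set.
  have hae : ∀ᵐ m : Plane, m ≠ u ∧ m ≠ y := by
    refine (?_ : ∀ᵐ m : Plane, m ≠ u).and ?_ <;> simp [ae_iff]
  have hin : ∀ᵐ m : Plane, ∫⁻ x, (if Blockage.hasRIS (m, x) = true ∧ Facing (m, x) u y then
      ENNReal.ofReal (PLoS lamB Lmin Lmax (dist (Blockage.midpoint (m, x)) u) *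
        PLoS lamB Lmin Lmax (dist (Blockage.midpoint (m, x)) y)) else 0)
      ∂((lengthLaw Lmin Lmax).prod (angleLaw.prod
        ((PMF.uniformOfFintype Bool).toMeasure.prod (bernoulliMeasure true false μ)))) =
      ENNReal.ofReal μ * ENNReal.ofReal (servingDensity lamB Lmin Lmax u y m) := by
    filter_upwards [hae] with m ⟨hu, hy⟩
    have hSm : MeasurableSet {x | Blockage.hasRIS (m, x) = true ∧ Facing (m, x) u y} :=
      measurable_prodMk_left hS
    have h1 := lintegral_indicator_const (μ := (lengthLaw Lmin Lmax).prod (angleLaw.prod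
      ((PMF.uniformOfFintype Bool).toMeasure.prod (bernoulliMeasure true false μ)))) hSm
      (ENNReal.ofReal (PLoS lamB Lmin Lmax (dist m u) * PLoS lamB Lmin Lmax (dist m y)))
    simp only [indicator_apply] at h1
    refine h1.trans ?_
    rw [lintegral_marks_facing Lmin Lmax μ hu.symm hy.symm,
      ← ENNReal.ofReal_mul (mul_nonneg (PLoS_nonneg _) (PLoS_nonneg _)),
      ← ENNReal.ofReal_mul μ.2.1, servingDensity]
    congr 1
    ring
  rw [lintegral_congr_ae hin, lintegral_const_mul' _ _ ENNReal.ofReal_ne_top,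
    ← ofReal_integral_eq_lintegral_ofReal (integrable_servingDensity hb u y)
      (Filter.Eventually.of_forall (servingDensity_nonneg u y)), smul_eq_mul, mul_assoc,
    ENNReal.ofReal_mul μ.2.1, ENNReal.ofReal_mul hlamB.le]
  ring

/-- Either all factors are `1` or some factor vanishes, so the infinite product has its intended
value whatever the index type. -/
theorem tprod_eq_ite_of_zero_or_one {ι : Type*} {f : ι → ℝ} (h : ∀ j, f j = 0 ∨ f j = 1)
    [Decidable (∀ j, f j = 1)] : ∏' j, f j = if ∀ j, f j = 1 then 1 else 0 := by
  split_ifs with h1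
  · simp [h1]
  · push Not at h1
    obtain ⟨j, hj⟩ := h1
    exact tprod_of_exists_eq_zero ⟨j, (h j).resolve_right hj⟩

open Classical in
theorem indirectIndicator_eq (blk : BlockageCopy → ℕ → Blockage) (u y : Plane) (i : ℕ) :
    indirectIndicator blk u y i = if IndirectLoS blk u y i then 1 else 0 := by
  rw [indirectIndicator, tprod_eq_ite_of_zero_or_one]
  · have : (∀ j : {j : ℕ // (blk (.carriers i) j).hasRIS = true},
        1 - losIndicator (blk (.userToRIS i j)) (blk (.carriers i) j).midpoint u *
          losIndicator (blk (.risToBS i j)) (blk (.carriers i) j).midpoint y *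
          facingIndicator (blk (.carriers i) j) u y = 1) ↔ ¬ IndirectLoS blk u y i := by
      simp only [IndirectLoS, losIndicator, facingIndicator, Subtype.forall]
      push Not
      refine forall_congr' fun j => forall_congr' fun _ => ?_
      split_ifs <;> simp_all
    simp only [this]
    split_ifs <;> simp_all
  · intro j
    simp only [losIndicator, facingIndicator]
    split_ifs <;> simp

open Classical in
theorem tprod_blind_eq (bs : ℕ → Plane) (blk : BlockageCopy → ℕ → Blockage) (u : Plane) :
    ∏' i, (1 - (losIndicator (blk (.direct i)) u (bs i) +
      (1 - losIndicator (blk (.direct i)) u (bs i)) * indirectIndicator blk u (bs i) i)) =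
      if ∀ i, ¬ (LoS (blk (.direct i)) u (bs i) ∨ IndirectLoS blk u (bs i) i) then 1 else 0 := by
  have h : ∀ i, 1 - (losIndicator (blk (.direct i)) u (bs i) +
      (1 - losIndicator (blk (.direct i)) u (bs i)) * indirectIndicator blk u (bs i) i) =
      if LoS (blk (.direct i)) u (bs i) ∨ IndirectLoS blk u (bs i) i then 0 else 1 := by
    intro i
    rw [indirectIndicator_eq, losIndicator]
    split_ifs <;> simp_all
  simp only [h]
  rw [tprod_eq_ite_of_zero_or_one]
  · congr 1
    refine propext (forall_congr' fun i => ?_)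
    split_ifs with hi <;> simp [hi]
  · intro i
    split_ifs <;> simp

end Events

/-! ### The probabilities of direct and indirect line-of-sight links -/

section Links

variable {Ω : Type*} [MeasurableSpace Ω] {P : Measure Ω}
  {lamB Lmin Lmax : ℝ} {μ : unitInterval} {blk : BlockageCopy → ℕ → Ω → Blockage}

/-- The blockages seen by the two hops through the `j`-th RIS offered to the `i`-th link. -/
def hopBlockages (blk : BlockageCopy → ℕ → Ω → Blockage) (i j : ℕ) (ω : Ω) : Hop :=
  (fun k => blk (.userToRIS i j) k ω, fun k => blk (.risToBS i j) k ω)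

/-- All the blockages that belong to the `i`-th link. -/
def linkBlockages (blk : BlockageCopy → ℕ → Ω → Blockage) (i : ℕ) (ω : Ω) :
    (ℕ → Blockage) × (ℕ → Blockage) × (ℕ → Hop) :=
  (fun k => blk (.direct i) k ω, fun k => blk (.carriers i) k ω, fun j => hopBlockages blk i j ω)

/-- Disjointness of such sets of copies yields the independence of RISs within a link, of its direct
and indirect paths, and of different links. -/
abbrev hopCopies (i j : ℕ) : Set BlockageCopy := {.userToRIS i j, .risToBS i j}

abbrev indirectCopies (i : ℕ) : Set BlockageCopy := {.carriers i} ∪ ⋃ j, hopCopies i j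

abbrev linkCopies (i : ℕ) : Set BlockageCopy := {.direct i} ∪ indirectCopies i

theorem measurable_hopBlockages {Ω : Type*} {blk : BlockageCopy → ℕ → Ω → Blockage}
    {S : Set BlockageCopy} {i j : ℕ} (hS : hopCopies i j ⊆ S) :
    Measurable[groupSigma (fun c ω k => blk c k ω) S] (hopBlockages blk i j) :=
  Measurable.prodMk (measurable_groupSigma (hS (by simp))) (measurable_groupSigma (hS (by simp)))

theorem measurable_forall_hopBlockages {Ω : Type*} {blk : BlockageCopy → ℕ → Ω → Blockage}
    {S : Set BlockageCopy} {i : ℕ} (hS : ⋃ j, hopCopies i j ⊆ S) :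
    Measurable[groupSigma (fun c ω k => blk c k ω) S] fun ω j => hopBlockages blk i j ω := by
  let := groupSigma (fun c ω k => blk c k ω) S
  exact measurable_pi_lambda _ fun j => measurable_hopBlockages ((subset_iUnion _ j).trans hS)

theorem measurable_linkBlockages {Ω : Type*} {blk : BlockageCopy → ℕ → Ω → Blockage} (i : ℕ) :
    Measurable[groupSigma (fun c ω k => blk c k ω) (linkCopies i)] (linkBlockages blk i) := by
  refine Measurable.prodMk (measurable_groupSigma (by simp))
    (Measurable.prodMk (measurable_groupSigma (by simp)) ?_)
  exact measurable_forall_hopBlockages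
    (subset_union_of_subset_right (subset_union_of_subset_right Subset.rfl _) _)

theorem exists_serves_iff {Ω : Type*} (blk : BlockageCopy → ℕ → Ω → Blockage) (u y : Plane)
    (i : ℕ) (ω : Ω) :
    (∃ j, Serves u y (blk (.carriers i) j ω) (hopBlockages blk i j ω)) ↔
      IndirectLoS (fun c k => blk c k ω) u y i := Iff.rfl

theorem measurable_blockages
    (hblk : ∀ c, IsPoissonProcess P (blk c) (blockageIntensity lamB Lmin Lmax μ))
    (c : BlockageCopy) : Measurable fun ω k => blk c k ω :=
  measurable_pi_lambda _ (hblk c).measurable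

open Classical in
-- With the carrier `b` fixed, its equipment and orientation are deterministic, and the two hops see
-- independent copies.
theorem prob_serves
    (hblk : ∀ c, IsPoissonProcess P (blk c) (blockageIntensity lamB Lmin Lmax μ))
    (hindep : iIndepFun (fun (c : BlockageCopy) (ω : Ω) (k : ℕ) => blk c k ω) P)
    (hlamB : 0 < lamB) (hLmin : 0 ≤ Lmin) (hLmax : Lmin < Lmax)
    (i j : ℕ) (u y : Plane) (b : Blockage) :
    P {ω | Serves u y b (hopBlockages blk i j ω)} = if b.hasRIS = true ∧ Facing b u y then
      ENNReal.ofReal (PLoS lamB Lmin Lmax (dist b.midpoint u) *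
        PLoS lamB Lmin Lmax (dist b.midpoint y)) else 0 := by
  split_ifs with h
  · have hi := hindep.indepFun (i := .userToRIS i j) (j := .risToBS i j) (by simp)
    have hm : ∀ q : Plane, MeasurableSet {B : ℕ → Blockage | LoS B b.midpoint q} := fun q =>
      measurableSet_LoS.preimage
        (f := fun B : ℕ → Blockage => (B, b.midpoint, q)) (by fun_prop)
    have h1 := hi.measure_inter_preimage_eq_mul _ _ (hm u) (hm y)
    have h2 : {ω | Serves u y b (hopBlockages blk i j ω)} =
        (fun ω k => blk (.userToRIS i j) k ω) ⁻¹' {B | LoS B b.midpoint u} ∩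
          (fun ω k => blk (.risToBS i j) k ω) ⁻¹' {B | LoS B b.midpoint y} := by
      ext ω
      simp [Serves, hopBlockages, h]
    rw [h2, h1, ENNReal.ofReal_mul (PLoS_nonneg _),
      ← (hblk (.userToRIS i j)).prob_LoS hlamB hLmin hLmax,
      ← (hblk (.risToBS i j)).prob_LoS hlamB hLmin hLmax]
    rfl
  · have : {ω | Serves u y b (hopBlockages blk i j ω)} = ∅ := by
      ext ω
      simp only [Serves, mem_ofPred_eq, mem_empty_iff_false]
      tauto
    rw [this, measure_empty]

/-- A void probability for the carriers of link `i`, thinned by their independent pairs of hop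
copies. -/
theorem prob_not_IndirectLoS [IsProbabilityMeasure P]
    (hblk : ∀ c, IsPoissonProcess P (blk c) (blockageIntensity lamB Lmin Lmax μ))
    (hindep : iIndepFun (fun (c : BlockageCopy) (ω : Ω) (k : ℕ) => blk c k ω) P)
    (hlamB : 0 < lamB) (hLmin : 0 ≤ Lmin) (hLmax : Lmin < Lmax)
    (i : ℕ) (u y : Plane) :
    P {ω | ¬ IndirectLoS (fun c k => blk c k ω) u y i} =
      ENNReal.ofReal (1 - PI lamB Lmin Lmax μ (dist u y)) := by
  classical
  have hb := beta_pos hlamB hLmin hLmax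
  have hmeas := measurable_blockages hblk
  have hhop : ∀ j, Measurable (hopBlockages blk i j) := fun j =>
    (hmeas _).prodMk (hmeas _)
  have hiI : iIndepFun (fun j => hopBlockages blk i j) P := by
    refine hindep.of_measurable_groupSigma hmeas (S := fun j => hopCopies i j) ?_
      fun j => measurable_hopBlockages Subset.rfl
    intro j k hjk
    simp [hjk.symm]
  have hiC : IndepFun (fun ω j => blk (.carriers i) j ω) (fun ω j => hopBlockages blk i j ω) P := by
    refine hindep.indepFun_of_measurable_groupSigma hmeas (S := {.carriers i})
      (T := ⋃ j, hopCopies i j) (by simp) (measurable_groupSigma (mem_singleton _)) ?_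
    exact measurable_forall_hopBlockages Subset.rfl
  have hA : MeasurableSet {x : Blockage × Hop | Serves u y x.1 x.2} :=
    (measurableSet_serves u).preimage (f := fun x : Blockage × Hop => (y, x)) (by fun_prop)
  have hΛ := lintegral_blockageIntensity_facing μ hlamB hLmin hLmax u y
  have h := (hblk (.carriers i)).prob_forall_notMem hhop hiI hiC hA
    (fun j b => prob_serves hblk hindep hlamB hLmin hLmax i j u y b)
    (by rw [hΛ]; exact ENNReal.ofReal_ne_top)
  rw [hΛ, ENNReal.toReal_ofReal (mul_nonneg (mul_nonneg μ.2.1 hlamB.le)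
    (integral_nonneg (servingDensity_nonneg u y)))] at h
  rw [PI_dist hb, sub_sub_cancel, ← h]
  congr 1
  ext ω
  rw [mem_ofPred_eq, ← exists_serves_iff, not_exists]
  rfl

/-- The direct copy is independent of everything used by the indirect paths, and `1 - Pv = (1 -
PLoS) * (1 - PI)`. -/
theorem prob_not_LoS_or_IndirectLoS [IsProbabilityMeasure P]
    (hblk : ∀ c, IsPoissonProcess P (blk c) (blockageIntensity lamB Lmin Lmax μ))
    (hindep : iIndepFun (fun (c : BlockageCopy) (ω : Ω) (k : ℕ) => blk c k ω) P)
    (hlamB : 0 < lamB) (hLmin : 0 ≤ Lmin) (hLmax : Lmin < Lmax)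
    (i : ℕ) (u y : Plane) :
    P {ω | ¬ (LoS (fun k => blk (.direct i) k ω) u y ∨
      IndirectLoS (fun c k => blk c k ω) u y i)} =
      ENNReal.ofReal (1 - Pv lamB Lmin Lmax μ (dist u y)) := by
  have hb := beta_pos hlamB hLmin hLmax
  have hmeas := measurable_blockages hblk
  have hLm : MeasurableSet {B : ℕ → Blockage | LoS B u y} :=
    measurableSet_LoS.preimage (f := fun B : ℕ → Blockage => (B, u, y)) (by fun_prop)
  have hIm : MeasurableSet {x : (ℕ → Blockage) × (ℕ → Hop) | ∃ j, Serves u y (x.1 j) (x.2 j)} :=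
    (measurableSet_exists_serves u).preimage
      (f := fun x : (ℕ → Blockage) × (ℕ → Hop) => (y, x)) (by fun_prop)
  have hi : IndepFun (fun ω k => blk (.direct i) k ω)
      (fun ω => ((fun k => blk (.carriers i) k ω, fun j => hopBlockages blk i j ω) :
        (ℕ → Blockage) × (ℕ → Hop))) P := by
    refine hindep.indepFun_of_measurable_groupSigma hmeas (S := {.direct i})
      (T := indirectCopies i) (by simp) (measurable_groupSigma (mem_singleton _)) ?_
    refine Measurable.prodMk (measurable_groupSigma (by simp)) ?_
    exact measurable_forall_hopBlockages (subset_union_of_subset_right Subset.rfl _)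
  have h1 := hi.measure_inter_preimage_eq_mul _ _ hLm.compl hIm.compl
  have h2 : P {ω | ¬ LoS (fun k => blk (.direct i) k ω) u y} =
      ENNReal.ofReal (1 - PLoS lamB Lmin Lmax (dist u y)) := by
    rw [ENNReal.ofReal_sub _ (PLoS_nonneg _), ENNReal.ofReal_one,
      ← (hblk (.direct i)).prob_LoS hlamB hLmin hLmax]
    exact prob_compl_eq_one_sub (hmeas _ hLm)
  have h3 := prob_not_IndirectLoS hblk hindep hlamB hLmin hLmax i u y
  have h4 : 1 - Pv lamB Lmin Lmax μ (dist u y) = (1 - PLoS lamB Lmin Lmax (dist u y)) *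
      (1 - PI lamB Lmin Lmax μ (dist u y)) := by
    unfold Pv PNLoS
    ring
  rw [h4, ENNReal.ofReal_mul (sub_nonneg.2 (PLoS_le_one hb dist_nonneg)), ← h2, ← h3]
  simp only [not_or]
  exact h1

end Links

/-! ### Thinning the base stations by visibility -/

theorem theorem1 {Ω : Type*} [MeasurableSpace Ω] (P : Measure Ω) [IsProbabilityMeasure P]
    (lamBS lamB Lmin Lmax : ℝ) (μ : unitInterval)
    (hlamBS : 0 < lamBS) (hlamB : 0 < lamB) (hLmin : 0 ≤ Lmin) (hLmax : Lmin < Lmax)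
    (bs : ℕ → Ω → Plane) (blk : BlockageCopy → ℕ → Ω → Blockage)
    (hbs : IsPoissonProcess P bs (ENNReal.ofReal lamBS • (volume : Measure Plane)))
    (hblk : ∀ c, IsPoissonProcess P (blk c) (blockageIntensity lamB Lmin Lmax μ))
    (hindep_copies : iIndepFun (fun (c : BlockageCopy) (ω : Ω) (k : ℕ) => blk c k ω) P)
    (hindep_bs : IndepFun (fun (ω : Ω) (i : ℕ) => bs i ω)
      (fun (ω : Ω) (c : BlockageCopy) (k : ℕ) => blk c k ω) P)
    (u : Plane) :
    (∀ (c : BlockageCopy) (a b : Plane),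
      P.real {ω | LoS (fun k => blk c k ω) a b} = PLoS lamB Lmin Lmax (dist a b)) ∧
    (∀ (i : ℕ) (y : Plane),
      P.real {ω | IndirectLoS (fun c k => blk c k ω) u y i} = PI lamB Lmin Lmax μ (dist u y)) ∧
    (∀ (i : ℕ) (y : Plane),
      P.real {ω | LoS (fun k => blk (.direct i) k ω) u y ∨
        IndirectLoS (fun c k => blk c k ω) u y i} = Pv lamB Lmin Lmax μ (dist u y)) ∧
    IntegrableOn (fun r => lamBS * Pv lamB Lmin Lmax μ r * r) (Ioi 0) ∧
    blindSpotRatio P bs blk u =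
      Real.exp (-(2 * Real.pi * ∫ r in Ioi (0 : ℝ), lamBS * Pv lamB Lmin Lmax μ r * r)) := by

  have hb := beta_pos hlamB hLmin hLmax
  have hmeas := measurable_blockages hblk
  have hlm : ∀ i, Measurable (linkBlockages blk i) := fun i =>
    (hmeas _).prodMk ((hmeas _).prodMk (measurable_pi_lambda _ fun j => (hmeas _).prodMk (hmeas _)))
  have hA : MeasurableSet {x : Plane × (ℕ → Blockage) × (ℕ → Blockage) × (ℕ → Hop) |
      LoS x.2.1 u x.1 ∨ ∃ j, Serves u x.1 (x.2.2.1 j) (x.2.2.2 j)} :=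
    (measurableSet_LoS.preimage (f := fun x : Plane × (ℕ → Blockage) × (ℕ → Blockage) × (ℕ → Hop) =>
      (x.2.1, u, x.1)) (by fun_prop)).union
    ((measurableSet_exists_serves u).preimage
      (f := fun x : Plane × (ℕ → Blockage) × (ℕ → Blockage) × (ℕ → Hop) => (x.1, x.2.2))
      (by fun_prop))
  have hIm : ∀ i y, MeasurableSet {ω | IndirectLoS (fun c k => blk c k ω) u y i} := fun i y =>
    (measurableSet_exists_serves u).preimage
      (f := fun ω => (y, (linkBlockages blk i ω).2)) (measurable_const.prodMk (hlm i).snd)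
  have hVm : ∀ i y, MeasurableSet {ω | LoS (fun k => blk (.direct i) k ω) u y ∨
      IndirectLoS (fun c k => blk c k ω) u y i} := fun i y =>
    hA.preimage (f := fun ω => (y, linkBlockages blk i ω)) (measurable_const.prodMk (hlm i))
  have hPI1 := fun y => PI_dist_mem_Icc (μ := μ) hb hlamB u y
  have hPv1 : ∀ y, Pv lamB Lmin Lmax μ (dist u y) ∈ Icc (0 : ℝ) 1 := fun y => by
    have h1 := PLoS_nonneg (lamB := lamB) (Lmin := Lmin) (Lmax := Lmax) (dist u y)
    have h2 := PLoS_le_one hb (dist_nonneg (x := u) (y := y))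
    have h3 := hPI1 y
    unfold Pv PNLoS
    constructor <;> nlinarith [h3.1, h3.2]
  have hV : ∀ i y, P.real {ω | LoS (fun k => blk (.direct i) k ω) u y ∨
      IndirectLoS (fun c k => blk c k ω) u y i} = Pv lamB Lmin Lmax μ (dist u y) := by
    intro i y
    have h1 := prob_not_LoS_or_IndirectLoS hblk hindep_copies hlamB hLmin hLmax i u y
    have h2 := probReal_compl_eq_one_sub (μ := P) (hVm i y)
    have h3 : P.real {ω | LoS (fun k => blk (.direct i) k ω) u y ∨
        IndirectLoS (fun c k => blk c k ω) u y i}ᶜ = 1 - Pv lamB Lmin Lmax μ (dist u y) := by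
      rw [measureReal_def]
      refine (congrArg ENNReal.toReal h1).trans (ENNReal.toReal_ofReal ?_)
      linarith [(hPv1 y).2]
    linarith
  refine ⟨fun c a b => ?_, fun i y => ?_, hV, integrableOn_Pv lamBS hb hlamB, ?_⟩
  · rw [measureReal_def, (hblk c).prob_LoS hlamB hLmin hLmax,
      ENNReal.toReal_ofReal (PLoS_nonneg _)]
  · have h1 := prob_not_IndirectLoS hblk hindep_copies hlamB hLmin hLmax i u y
    have h2 := probReal_compl_eq_one_sub (μ := P) (hIm i y)
    have h3 : P.real {ω | IndirectLoS (fun c k => blk c k ω) u y i}ᶜ =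
        1 - PI lamB Lmin Lmax μ (dist u y) := by
      rw [measureReal_def]
      refine (congrArg ENNReal.toReal h1).trans (ENNReal.toReal_ofReal ?_)
      linarith [(hPI1 y).2]
    linarith
  · have hi : iIndepFun (linkBlockages blk) P := by
      refine hindep_copies.of_measurable_groupSigma hmeas (S := linkCopies) ?_
        measurable_linkBlockages
      intro i j hij
      refine Set.disjoint_left.2 fun c hi hj => hij ?_
      simp only [linkCopies, indirectCopies, hopCopies, mem_union, mem_singleton_iff, mem_iUnion,
        mem_insert_iff] at hi hj
      cases c <;> simp at hi hj <;> omega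
    have hbi : IndepFun (fun ω i => bs i ω) (fun ω i => linkBlockages blk i ω) P := by
      -- Regrouping the copies link by link is a measurable map, so independence from the base
      -- stations is inherited.
      have hψ : Measurable fun (B : BlockageCopy → ℕ → Blockage) (i : ℕ) =>
          ((B (.direct i), B (.carriers i), fun j => (B (.userToRIS i j), B (.risToBS i j))) :
            (ℕ → Blockage) × (ℕ → Blockage) × (ℕ → Hop)) := by
        refine measurable_pi_lambda _ fun i => ?_
        fun_prop
      exact hindep_bs.comp measurable_id hψ
    have hg : ∀ i y, P {ω | (y, linkBlockages blk i ω) ∈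
        {x : Plane × (ℕ → Blockage) × (ℕ → Blockage) × (ℕ → Hop) |
          LoS x.2.1 u x.1 ∨ ∃ j, Serves u x.1 (x.2.2.1 j) (x.2.2.2 j)}} =
        ENNReal.ofReal (Pv lamB Lmin Lmax μ (dist u y)) := by
      intro i y
      rw [← hV i y, ofReal_measureReal]
      rfl
    have hΛ := lintegral_Pv_dist (μ := μ) hlamBS hb hlamB u
    -- The second use of thinning: the points are the base stations, and the mark of each is the
    -- whole blockage environment of its link.
    have h := hbs.prob_forall_notMem hlm hi hbi hA hg (by rw [hΛ]; exact ENNReal.ofReal_ne_top)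
    have hnn : 0 ≤ 2 * Real.pi * ∫ r in Ioi (0 : ℝ), lamBS * Pv lamB Lmin Lmax μ r * r := by
      refine mul_nonneg Real.two_pi_pos.le (setIntegral_nonneg measurableSet_Ioi fun r hr => ?_)
      -- Nonnegativity of `Pv` is available at norms of vectors, so a vector of norm `r` is
      -- produced.
      have hr' : ‖(r • !₂[Real.cos 0, Real.sin 0] : Plane)‖ = r := norm_cos_sin r 0 (le_of_lt hr)
      have := (Pv_norm_bounds (μ := μ) hb hlamB (r • !₂[Real.cos 0, Real.sin 0] : Plane)).1
      rw [hr'] at this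
      exact mul_nonneg (mul_nonneg hlamBS.le this) (le_of_lt hr)
    rw [hΛ, ENNReal.toReal_ofReal hnn] at h
    have hm : MeasurableSet {ω | ∀ i, ¬ (LoS (fun k => blk (.direct i) k ω) u (bs i ω) ∨
        IndirectLoS (fun c k => blk c k ω) u (bs i ω) i)} := by
      have : {ω | ∀ i, ¬ (LoS (fun k => blk (.direct i) k ω) u (bs i ω) ∨
          IndirectLoS (fun c k => blk c k ω) u (bs i ω) i)} =
          ⋂ i, ((fun ω => (bs i ω, linkBlockages blk i ω)) ⁻¹'
            {x : Plane × (ℕ → Blockage) × (ℕ → Blockage) × (ℕ → Hop) |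
              LoS x.2.1 u x.1 ∨ ∃ j, Serves u x.1 (x.2.2.1 j) (x.2.2.2 j)})ᶜ := by
        ext ω
        simp only [mem_iInter]
        rfl
      rw [this]
      exact MeasurableSet.iInter fun i => (((hbs.measurable i).prodMk (hlm i)) hA).compl
    classical
    rw [blindSpotRatio]
    have hpt := fun ω => tprod_blind_eq (fun i => bs i ω) (fun c k => blk c k ω) u
    simp only [hpt]
    have h4 := integral_indicator_one (μ := P) hm
    simp only [indicator_apply, mem_ofPred_eq, Pi.one_apply] at h4
    rw [h4, measureReal_def]
    exact (congrArg ENNReal.toReal h).trans (ENNReal.toReal_ofReal (Real.exp_pos _).le)
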